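/- Let $K$ be a positive integer, $[K]=\{1,\dots,K\}$. A memoryless 1-to-$K$ broadcast packet erasure channel is given by numbers $p_{S}\ge 0$ ($S\subseteq[K]$) with $\sum_{S\subseteq[K]}p_S=1$: in each time slot a symbol of a finite field $\mathrm{GF}(q)$ is sent, it is received by exactly the receivers in $S$ with probability $p_S$ and seen as an erasure by the others, independently over the time slots and of the messages. Put $$p_{\cup S}=\sum_{S':\,S'\cap S\ne\emptyset}p_{S'},\qquad f_p(S\overline{T})=\sum_{S_1:\,S\subseteq S_1,\ T\subseteq[K]\setminus S_1}p_{S_1}\quad(S\cap T=\emptyset).$$ *Achievability.* With channel output feedback, the symbol sent in slot $t$ is a function of all messages and of the outputs of all $K$ receivers in slots $1,\dots,t-1$, and receiver $k$ estimates its message from its own $n$ outputs only. A rate vector $R\in[0,\infty)^K$ is achievable if for every $\epsilon>0$ and all sufficiently large $n$, for all sufficiently large finite fields $\mathrm{GF}(q)$ (how large may depend on $n$), there is such a scheme with $n$ channel uses in which the message of session $k$ consists of $\lceil nR_k\rceil$ symbols of $\mathrm{GF}(q)$ for each $k\in[K]$, all message symbols being independent and uniform, and each receiver $k$ errs with probability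 less than $\epsilon$. *The regions.* A strict total order $\prec$ on the subsets of $[K]$ is cardinality-compatible if $|S_1|<|S_2|$ implies $S_1\prec S_2$. For such an order let $\Lambda_\prec$ be the set of all $R\in[0,\infty)^K$ for which there are $x_S\ge0$ ($S\subseteq[K]$) and $w_{k;S\to T}\ge0$ ($k\in[K]$, $T\subseteq S\subseteq[K]\setminus\{k\}$) such that 1. $\sum_{S\subseteq[K]}x_S<1$; 2. $x_T\ge\sum_{S:\,T\setminus\{k\}\subseteq S\subseteq[K]\setminus\{k\}}w_{k;S\to T\setminus\{k\}}$ for all $T\subseteq[K]$ and $k\in T$; 3. $w_{k;\emptyset\to\emptyset}\,p_{\cup[K]}\ge R_k$ for all $k\in[K]$; 4. for all $k\in[K]$ and all nonempty $S\subseteq[K]\setminus\{k\}$, $$\Big(\sum_{T_1\subseteq S}w_{k;S\to T_1}\Big)p_{\cup([K]\setminus S)}\ \ge\sum_{\substack{(S_1,T_1):\ T_1\subseteq S_1\subseteq[K]\setminus\{k\},\\ T_1\subseteq S,\ S\not\subseteq S_1}}w_{k;S_1\to T_1}\,f_p\big((S\setminus T_1)\overline{([K]\setminus S)}\big);$$ 5.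 for all $k\in[K]$ and all $T\subsetneq S\subseteq[K]\setminus\{k\}$, $$\Big(w_{k;S\to T}+\sum_{\substack{T_1\subseteq S,\\ T_1\cup\{k\}\prec T\cup\{k\}}}w_{k;S\to T_1}\Big)p_{\cup([K]\setminus S)}\ \le\sum_{\substack{S_1\prec S,\\ T\subseteq S_1\subseteq[K]\setminus\{k\}}}w_{k;S_1\to T}\,f_p\big((S\setminus T)\overline{([K]\setminus S)}\big)+\sum_{\substack{(S_1,T_1):\ T_1\subseteq S_1\subseteq[K]\setminus\{k\},\\ T_1\cup\{k\}\prec T\cup\{k\},\\ T_1\subseteq S,\ S\not\subseteq S_1}}w_{k;S_1\to T_1}\,f_p\big((S\setminus T_1)\overline{([K]\setminus S)}\big).$$ *Statement.* Every rate vector in the convex hull of $\bigcup_\prec\Lambda_\prec$, the union being over all cardinality-compatible strict total orders $\prec$ on the subsets of $[K]$, is achievable. -/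

import Mathlib

noncomputable section

open scoped Classical

/-- A memoryless 1-to-`K` broadcast packet erasure channel: `prob S` is the probability that a
transmitted symbol is received by exactly the receivers in `S`. -/
structure BroadcastPEC (K : ℕ) where
  prob : Finset (Fin K) → ℝ
  prob_nonneg : ∀ S, 0 ≤ prob S
  sum_prob : ∑ S, prob S = 1

/-- What the `K` receivers observe when `y` is sent and the set of successful receivers is `S`;
`none` is the erasure symbol. -/
def channelOutput {K : ℕ} {F : Type} (y : F) (S : Finset (Fin K)) : Fin K → Option F :=
  fun k => if k ∈ S then some y else none

/-- A family of messages: session `k` consists of `m k` information symbols in `F`. -/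
abbrev Messages {K : ℕ} (m : Fin K → ℕ) (F : Type) : Type :=
  (k : Fin K) → Fin (m k) → F

/-- A code with `n` channel uses and instant channel output feedback. The symbol sent in slot `t`
is a function of all messages and of the channel outputs in the slots before `t`; receiver `k`
decodes from its own `n` outputs only. -/
structure FeedbackCode {K : ℕ} (n : ℕ) (m : Fin K → ℕ) (F : Type) where
  enc : (t : Fin n) → Messages m F → (Set.Iio t → Fin K → Option F) → F
  dec : (k : Fin K) → (Fin n → Option F) → (Fin (m k) → F)

namespace FeedbackCode

variable {K n : ℕ} {m : Fin K → ℕ} {F : Type}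

/-- The channel output vector in slot `t`, for messages `X` and success sets `s`. -/
def output (c : FeedbackCode n m F) (X : Messages m F) (s : Fin n → Finset (Fin K))
    (t : Fin n) : Fin K → Option F :=
  channelOutput (c.enc t X (fun τ => output c X s τ.1)) (s t)
termination_by t.val
decreasing_by exact τ.2

/-- The estimate that receiver `k` makes of its message. -/
def decoded (c : FeedbackCode n m F) (X : Messages m F) (s : Fin n → Finset (Fin K))
    (k : Fin K) : Fin (m k) → F :=
  c.dec k (fun t => c.output X s t k)

/-- The probability that receiver `k` decodes wrongly, when the messages are uniformly distributed
and, independently of them, the success sets of the `n` slots are i.i.d. with law `ch.prob`. -/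
def errorProb [Fintype F] (ch : BroadcastPEC K) (c : FeedbackCode n m F) (k : Fin K) : ℝ :=
  ∑ X : Messages m F, ∑ s : Fin n → Finset (Fin K),
    (1 / (Fintype.card (Messages m F) : ℝ)) * (∏ t, ch.prob (s t)) *
      (if c.decoded X s k ≠ X k then 1 else 0)

end FeedbackCode

namespace BroadcastPEC

variable {K : ℕ}

/-- Achievability of a rate vector: for all sufficiently large block lengths `n`, and then all
sufficiently large finite fields `F`, there is a code carrying `⌈n R k⌉` symbols of session `k` for
every `k`, each session having error probability less than `ε`. -/
def Achievable (ch : BroadcastPEC K) (R : Fin K → ℝ) : Prop :=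
  (∀ k, 0 ≤ R k) ∧
    ∀ ε : ℝ, 0 < ε → ∃ N : ℕ, ∀ n : ℕ, N ≤ n → ∃ Q : ℕ,
      ∀ (F : Type) [Field F] [Fintype F], Q ≤ Fintype.card F →
        ∃ c : FeedbackCode n (fun k => ⌈(n : ℝ) * R k⌉₊) F, ∀ k, c.errorProb ch k < ε

/-- The probability that at least one receiver in `S` receives the transmitted symbol. -/
def pUnion (ch : BroadcastPEC K) (S : Finset (Fin K)) : ℝ :=
  ∑ S' with (S' ∩ S).Nonempty, ch.prob S'

/-- The probability that all receivers in `S` and no receiver in `T` receive the transmitted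
symbol. -/
def fp (ch : BroadcastPEC K) (S T : Finset (Fin K)) : ℝ :=
  ∑ S₁ with S ⊆ S₁ ∧ T ⊆ S₁ᶜ, ch.prob S₁

end BroadcastPEC

/-- A relation on the subsets of `[K]` that sorts smaller sets before larger ones. -/
def CardCompatible {K : ℕ} (r : Finset (Fin K) → Finset (Fin K) → Prop) : Prop :=
  ∀ S₁ S₂ : Finset (Fin K), S₁.card < S₂.card → r S₁ S₂

/-- The linear inequalities in the rates `R`, the variables `x S` and the variables `w k S T`, of
which only those with `T ⊆ S ⊆ [K] \ {k}` are used. -/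
structure InnerFeasible {K : ℕ} (ch : BroadcastPEC K)
    (r : Finset (Fin K) → Finset (Fin K) → Prop) (R : Fin K → ℝ)
    (x : Finset (Fin K) → ℝ) (w : Fin K → Finset (Fin K) → Finset (Fin K) → ℝ) : Prop where
  x_nonneg : ∀ S, 0 ≤ x S
  w_nonneg : ∀ k S T, T ⊆ S → S ⊆ {k}ᶜ → 0 ≤ w k S T
  total : ∑ S, x S < 1
  coding_len : ∀ T : Finset (Fin K), ∀ k ∈ T,
    ∑ S with T \ {k} ⊆ S ∧ S ⊆ {k}ᶜ, w k S (T \ {k}) ≤ x T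
  rate : ∀ k, R k ≤ w k ∅ ∅ * ch.pUnion Finset.univ
  clean_up : ∀ k, ∀ S : Finset (Fin K), S ⊆ {k}ᶜ → S ≠ ∅ →
    ∑ q : Finset (Fin K) × Finset (Fin K) with
        q.2 ⊆ q.1 ∧ q.1 ⊆ {k}ᶜ ∧ q.2 ⊆ S ∧ ¬ S ⊆ q.1,
      w k q.1 q.2 * ch.fp (S \ q.2) Sᶜ
      ≤ (∑ T₁ with T₁ ⊆ S, w k S T₁) * ch.pUnion Sᶜ
  causality : ∀ k, ∀ S T : Finset (Fin K), T ⊆ S → S ⊆ {k}ᶜ → T ≠ S →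
    (w k S T + ∑ T₁ with T₁ ⊆ S ∧ r (T₁ ∪ {k}) (T ∪ {k}), w k S T₁) * ch.pUnion Sᶜ
      ≤ (∑ S₁ with r S₁ S ∧ T ⊆ S₁ ∧ S₁ ⊆ {k}ᶜ, w k S₁ T * ch.fp (S \ T) Sᶜ)
        + ∑ q : Finset (Fin K) × Finset (Fin K) with
            q.2 ⊆ q.1 ∧ q.1 ⊆ {k}ᶜ ∧ r (q.2 ∪ {k}) (T ∪ {k}) ∧ q.2 ⊆ S ∧ ¬ S ⊆ q.1,
          w k q.1 q.2 * ch.fp (S \ q.2) Sᶜ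

/-- The region `Λ` of the ordering `r`: all rate vectors for which the inequalities have a
solution. -/
def innerRegion {K : ℕ} (ch : BroadcastPEC K)
    (r : Finset (Fin K) → Finset (Fin K) → Prop) : Set (Fin K → ℝ) :=
  {R | (∀ k, 0 ≤ R k) ∧ ∃ x w, InnerFeasible ch r R x w}

end

/-! The scheme lets coded packets evolve. A packet of session k has an overhearing set S and a
coding vector that each receiver in S ∪ {k} sees as something it has already observed plus a
combination of its own symbols. Under coding set T, at most one packet per session k ∈ T with T \
{k} ⊆ S is mixed in, so the mix is harmless to all of T. If the set A of successful receivers is not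
contained in S, the mix replaces the packet and the overhearing set becomes (T \ {k}) ∪ A; the
packet is finished once this contains k. Over a field with more than K elements, proper subspaces of
coefficients, at most one per session, can be avoided simultaneously, so some mix can stand in for
every packet it replaces (`exists_mix_innovative`, `exists_valid_step`). When all packets of session
k are finished, the observations of k span its message (`eq_of_sent_eq`).

What remains is a queueing problem. The weight w_{k;S→T} is the fraction of slots in which session k
sends packets from S with coding set T ∪ {k}. Condition 4 says that the total service of S covers
its arrivals; subtracting condition 5 shows that the arrivals after any block of S are covered by
the service after it (`late_of_causality`). Suppose packets remained in S after its last block.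
Counting from the last earlier block that ends with S empty, or from the start if there is none, no
service is wasted, so departures make up for arrivals: a contradiction (`packetCount_eq_zero`). This
is deterministic once receptions are near their means. Chebyshev's inequality makes that likely, and
a linear margin absorbs the deviations (`Typical.hits_balance`); the margin comes from lengthening
the blocks T = S geometrically in |S| (`exists_strictlyFeasible`).

A receiver does not know the erasures of the others. The slack 1 - ∑ x leaves linearly many slots in
which the whole success pattern is repeated as one symbol of a large field, and each receiver of
positive reception probability is likely to get a copy (`decoded_code`, `Typical.exists_header`). A
receiver that almost surely gets nothing has rate 0 by flow conservation (`rate_nonpos`). Convex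
combinations are time sharing: one group of packets per point, each with its own order, served in
succession. -/

noncomputable section

open scoped Classical

/-! ### Packet evolution: the linear algebra -/

/-- The elementary coding vector of symbol `j` of session `k`. -/
def symbolDual {K : ℕ} (m : Fin K → ℕ) (F : Type) [Field F] (k : Fin K) (j : Fin (m k)) :
    Module.Dual F (Messages m F) :=
  (LinearMap.proj j).comp (LinearMap.proj (R := F) (φ := fun k => Fin (m k) → F) k)

/-- The state of a packet evolution scheme: the overhearing set and the representative coding
vector of each packet, and for each receiver the span of the coding vectors it has received. -/
structure PacketState {K : ℕ} (m : Fin K → ℕ) (F : Type) [Field F] where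
  heard : (k : Fin K) → Fin (m k) → Finset (Fin K)
  vec : (k : Fin K) → Fin (m k) → Module.Dual F (Messages m F)
  obs : Fin K → Submodule F (Module.Dual F (Messages m F))

namespace PacketState

open Submodule

variable {K : ℕ} {m : Fin K → ℕ} {F : Type} [Field F]

/-- The coding vectors that only involve symbols of session `k`. -/
def messageSpan (m : Fin K → ℕ) (F : Type) [Field F] (k : Fin K) :
    Submodule F (Module.Dual F (Messages m F)) :=
  span F (Set.range (symbolDual m F k))

/-- What receiver `k` would know after receiving all its unfinished packets that satisfy `p`. -/
def reach (st : PacketState m F) (k : Fin K) (p : Fin (m k) → Prop) :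
    Submodule F (Module.Dual F (Messages m F)) :=
  st.obs k ⊔ span F (st.vec k '' {j | k ∉ st.heard k j ∧ p j})

/-- Each packet is non-interfering for the receivers that overheard it and for its own receiver,
and the unfinished packets of session `k` suffice for receiver `k`. -/
structure Valid (st : PacketState m F) : Prop where
  vec_mem : ∀ k j, ∀ i ∈ insert k (st.heard k j), st.vec k j ∈ st.obs i ⊔ messageSpan m F i
  message_le : ∀ k, messageSpan m F k ≤ st.reach k fun _ => True

/-- The initial state. -/
def init (m : Fin K → ℕ) (F : Type) [Field F] : PacketState m F where
  heard _ _ := ∅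
  vec := symbolDual m F
  obs _ := ⊥

lemma valid_init : (init m F).Valid where
  vec_mem k j i hi := by
    have : i = k := by simpa [init] using hi
    subst this
    exact mem_sup_right (subset_span ⟨j, rfl⟩)
  message_le k := by
    refine le_trans (le_of_eq ?_) le_sup_right
    simp [messageSpan, init]

/-- The update of the state when `u` is sent with coding set `T` and packets `sel`, and received by
the receivers in `A`. -/
def step (st : PacketState m F) (T : Finset (Fin K)) (sel : (k : Fin K) → Option (Fin (m k)))
    (u : Module.Dual F (Messages m F)) (A : Finset (Fin K)) : PacketState m F where
  -- Members of the old set outside `T` and `A` are dropped, since `u` may contain packets they have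
  -- not overheard. A reception inside the old set changes nothing.
  heard k j := if sel k = some j ∧ ¬ A ⊆ st.heard k j then T \ {k} ∪ A else st.heard k j
  vec k j := if sel k = some j ∧ ¬ A ⊆ st.heard k j then u else st.vec k j
  obs i := if i ∈ A then st.obs i ⊔ span F {u} else st.obs i

/-- The packets `sel` may be mixed under the coding set `T`. -/
def Selectable (st : PacketState m F) (T : Finset (Fin K))
    (sel : (k : Fin K) → Option (Fin (m k))) : Prop :=
  ∀ k j, sel k = some j → k ∈ T ∧ k ∉ st.heard k j ∧ T \ {k} ⊆ st.heard k j

/-- One-vector exchange: `u ∉ W` forces a nonzero coefficient of `v`. Here `W` is what a receiver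
can reach without a packet `v`, which may then be traded for the mix `u`. -/
lemma mem_sup_span_exchange {V : Type*} [AddCommGroup V] [Module F V] {W : Submodule F V} {u v : V}
    (hu : u ∈ W ⊔ span F {v}) (h : u ∉ W) : v ∈ W ⊔ span F {u} := by
  obtain ⟨w, hw, y, hy, rfl⟩ := mem_sup.1 hu
  obtain ⟨a, rfl⟩ := mem_span_singleton.1 hy
  have ha : a ≠ 0 := by
    rintro rfl
    exact h (by simpa using hw)
  have : v = -(a⁻¹ • w) + a⁻¹ • (w + a • v) := by
    rw [smul_add, smul_smul, inv_mul_cancel₀ ha, one_smul]; abel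
  rw [this]
  refine add_mem (mem_sup_left (neg_mem (smul_mem _ _ hw)))
    (mem_sup_right (smul_mem _ _ ?_))
  rw [← this]
  exact mem_span_singleton_self _

/-- The combination with coefficients `c` of the selected packets. -/
def mix (st : PacketState m F) (sel : (k : Fin K) → Option (Fin (m k))) :
    (Fin K → F) →ₗ[F] Module.Dual F (Messages m F) :=
  Fintype.linearCombination F fun k => ((sel k).map (st.vec k)).getD 0

lemma mix_single (st : PacketState m F) (sel : (k : Fin K) → Option (Fin (m k))) {k : Fin K}
    {j : Fin (m k)} (h : sel k = some j) : st.mix sel (Pi.single k 1) = st.vec k j := by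
  simp [mix, Fintype.linearCombination_apply_single, h]

/-- A receiver in `T` has overheard every selected packet of the other sessions, and its own packet
is covered by the `insert` in `vec_mem`. -/
lemma mix_mem (st : PacketState m F) {T : Finset (Fin K)}
    {sel : (k : Fin K) → Option (Fin (m k))} (hst : st.Valid) (hsel : st.Selectable T sel)
    (c : Fin K → F) {i : Fin K} (hi : i ∈ T) :
    st.mix sel c ∈ st.obs i ⊔ messageSpan m F i := by
  rw [mix, Fintype.linearCombination_apply]
  refine sum_mem fun k _ => smul_mem _ _ ?_
  cases h : sel k with
  | none => simp
  | some j =>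
    obtain ⟨-, -, h3⟩ := hsel k j h
    refine hst.vec_mem k j i ?_
    by_cases hik : i = k
    · simp [hik]
    · exact Finset.mem_insert_of_mem (h3 (by simp [hi, hik]))

lemma reach_split (st : PacketState m F) (k : Fin K) (j : Fin (m k)) :
    st.reach k (fun _ => True) ≤ st.reach k (· ≠ j) ⊔ span F {st.vec k j} := by
  refine sup_le (le_sup_of_le_left le_sup_left) (span_le.2 ?_)
  rintro _ ⟨i, ⟨hi, -⟩, rfl⟩
  by_cases h : i = j
  · subst h; exact mem_sup_right (mem_span_singleton_self _)
  · exact mem_sup_left (mem_sup_right (subset_span ⟨i, ⟨hi, h⟩, rfl⟩))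

/-- Over a field with more than `K` elements some combination is innovative for every session that
takes part in it. -/
lemma exists_mix_innovative (st : PacketState m F) {T : Finset (Fin K)}
    {sel : (k : Fin K) → Option (Fin (m k))} (hst : st.Valid) (hsel : st.Selectable T sel)
    (hF : (K : ℕ∞) < ENat.card F) :
    ∃ c : Fin K → F, ∀ k j, sel k = some j →
      st.vec k j ∈ st.reach k (· ≠ j) ⊔ span F {st.mix sel c} := by
  let p : (Σ k, Fin (m k)) → Submodule F (Fin K → F) := fun q =>
    (st.reach q.1 (· ≠ q.2)).comap (st.mix sel)
  -- Packets with `p q = ⊤` impose no condition: they already lie in the reach of the others. The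
  -- remaining subspaces are proper and at most one per session, so they do not cover the
  -- coefficient space.
  let s : Finset (Σ k, Fin (m k)) := {q | sel q.1 = some q.2 ∧ p q ≠ ⊤}
  have hs : s.card ≤ K := by
    calc s.card ≤ (Finset.univ : Finset (Fin K)).card := by
          refine Finset.card_le_card_of_injOn Sigma.fst (by simp) ?_
          rintro ⟨k, j⟩ h ⟨k', j'⟩ h' (rfl : k = k')
          simp only [s, Finset.coe_filter, Finset.mem_univ, true_and, Set.mem_ofPred_eq] at h h'
          have := h.1.symm.trans h'.1
          simp_all
      _ = K := by simp
  obtain ⟨c, hc⟩ : ∃ c, ∀ q ∈ s, c ∉ p q := by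
    have := iUnion_ssubset_of_forall_ne_top_of_card_lt (K := F) (Finset.univ : Finset s)
      (fun q => p q) (fun q => (Finset.mem_filter.1 q.2).2.2)
      (lt_of_le_of_lt (by simpa using hs) hF)
    obtain ⟨c, hc⟩ := (Set.ne_univ_iff_exists_notMem _).1 this.ne
    exact ⟨c, fun q hq hcq => hc (Set.mem_iUnion₂.2 ⟨⟨q, hq⟩, Finset.mem_univ _, hcq⟩)⟩
  refine ⟨c, fun k j hkj => ?_⟩
  by_cases h : st.vec k j ∈ st.reach k (· ≠ j)
  · exact mem_sup_left h
  obtain ⟨h1, h2, h3⟩ := hsel k j hkj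
  refine mem_sup_span_exchange ?_ (hc ⟨k, j⟩ (by
    simp only [s, Finset.mem_filter, Finset.mem_univ, true_and]
    refine ⟨hkj, fun htop => h ?_⟩
    have : Pi.single k 1 ∈ p ⟨k, j⟩ := htop ▸ mem_top
    simpa [p, mix_single st sel hkj] using this))
  have := st.mix_mem hst hsel c h1
  exact sup_le (le_sup_of_le_left le_sup_left)
    ((hst.message_le k).trans (st.reach_split k j)) this

lemma obs_le_step (st : PacketState m F) (T : Finset (Fin K)) (sel u A) (i : Fin K) :
    st.obs i ≤ (st.step T sel u A).obs i := by
  simp only [step]; split_ifs <;> simp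

/-- One `u` has to work for every `A`, because it is sent before `A` is known. A replaced vector is
recoverable from the other packets and `u`, and receiver `k` either observes `u` or keeps it as the
new vector of an unfinished packet. -/
lemma exists_valid_step (st : PacketState m F) {T : Finset (Fin K)}
    {sel : (k : Fin K) → Option (Fin (m k))} (hst : st.Valid) (hsel : st.Selectable T sel)
    (hF : (K : ℕ∞) < ENat.card F) :
    ∃ u, ∀ A, (st.step T sel u A).Valid := by
  obtain ⟨c, hc⟩ := st.exists_mix_innovative hst hsel hF
  refine ⟨st.mix sel c, fun A => ⟨fun k j i hi => ?_, fun k => ?_⟩⟩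
  · by_cases h : sel k = some j ∧ ¬ A ⊆ st.heard k j
    · simp only [step, if_pos h] at hi ⊢
      by_cases hA : i ∈ A
      · rw [if_pos hA]
        exact mem_sup_left (mem_sup_right (mem_span_singleton_self _))
      · rw [if_neg hA]
        refine st.mix_mem hst hsel c ?_
        have := (hsel k j h.1).1
        simp only [Finset.mem_insert, Finset.mem_union, Finset.mem_sdiff, hA] at hi
        aesop
    · have hv : (st.step T sel (st.mix sel c) A).vec k j = st.vec k j := by simp only [step, if_neg h]
      have hh : (st.step T sel (st.mix sel c) A).heard k j = st.heard k j := by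
        simp only [step, if_neg h]
      rw [hv]
      rw [hh] at hi
      exact sup_le_sup_right (st.obs_le_step ..) _ (hst.vec_mem k j i hi)
  · refine (hst.message_le k).trans ?_
    have key : ∀ j, ¬ (sel k = some j ∧ ¬ A ⊆ st.heard k j) → k ∉ st.heard k j →
        st.vec k j ∈ (st.step T sel (st.mix sel c) A).reach k fun _ => True := by
      intro j h hk
      refine mem_sup_right (subset_span ⟨j, ?_, ?_⟩)
      · simpa [step, h] using hk
      · simp only [step, if_neg h]
    refine sup_le ((st.obs_le_step ..).trans le_sup_left) (span_le.2 ?_)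
    rintro _ ⟨j, ⟨hj, -⟩, rfl⟩
    by_cases h : sel k = some j ∧ ¬ A ⊆ st.heard k j
    · refine sup_le (sup_le ((st.obs_le_step ..).trans le_sup_left) (span_le.2 ?_))
        (span_le.2 ?_) (hc k j h.1)
      · rintro _ ⟨i, ⟨hi, hij⟩, rfl⟩
        exact key i (fun h' => hij (Option.some_injective _ (h'.1.symm.trans h.1))) hi
      · rw [Set.singleton_subset_iff]
        by_cases hA : k ∈ A
        · refine mem_sup_left ?_
          simp only [step, if_pos hA]
          exact mem_sup_right (mem_span_singleton_self _)
        · refine mem_sup_right (subset_span ⟨j, ?_, ?_⟩)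
          · simpa [step, h] using hA
          · simp only [step, if_pos h]
    · exact key j h hj

end PacketState
end

noncomputable section

open scoped Classical

/-! ### Packet evolution: following a plan -/

/-- A plan fixes for each slot the coding set, and for each session the group and the overhearing
set of the packets that are to be sent. -/
structure PacketPlan (K : ℕ) (G : Type) where
  phase : ℕ → Finset (Fin K)
  source : ℕ → Fin K → Option (G × Finset (Fin K))
  compatible : ∀ t k g S, source t k = some (g, S) → k ∈ phase t ∧ k ∉ S ∧ phase t \ {k} ⊆ S

namespace PacketPlan

open PacketState

variable {K : ℕ} {G : Type} {m : Fin K → ℕ} {F : Type} [Field F]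

/-- A packet of session `k` that the plan wants to be sent in slot `t`, if there is one. -/
def select (P : PacketPlan K G) (grp : (k : Fin K) → Fin (m k) → G) (st : PacketState m F) (t : ℕ)
    (k : Fin K) : Option (Fin (m k)) :=
  if h : ∃ j, P.source t k = some (grp k j, st.heard k j) then some h.choose else none

lemma select_eq_some {P : PacketPlan K G} {grp : (k : Fin K) → Fin (m k) → G}
    {st : PacketState m F} {t : ℕ} {k : Fin K} {j : Fin (m k)} (h : P.select grp st t k = some j) :
    P.source t k = some (grp k j, st.heard k j) := by
  unfold select at h
  split_ifs at h with h'
  rw [← Option.some_injective _ h]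
  exact h'.choose_spec

lemma selectable_select (P : PacketPlan K G) (grp : (k : Fin K) → Fin (m k) → G)
    (st : PacketState m F) (t : ℕ) : st.Selectable (P.phase t) (P.select grp st t) :=
  fun k _ h => P.compatible t k _ _ (select_eq_some h)

/-- The coding vector sent in slot `t`. -/
def innovative (P : PacketPlan K G) (grp : (k : Fin K) → Fin (m k) → G) (st : PacketState m F)
    (t : ℕ) : Module.Dual F (Messages m F) :=
  if h : ∃ u, ∀ A, (st.step (P.phase t) (P.select grp st t) u A).Valid then h.choose else 0

/-- The state before slot `t`, if slot `τ` is received by the receivers in `s τ`. -/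
def evolve (P : PacketPlan K G) (F : Type) [Field F] (grp : (k : Fin K) → Fin (m k) → G)
    (s : ℕ → Finset (Fin K)) : ℕ → PacketState m F
  | 0 => PacketState.init m F
  | t + 1 => (evolve P F grp s t).step (P.phase t) (P.select grp (evolve P F grp s t) t)
      (P.innovative grp (evolve P F grp s t) t) (s t)

/-- The coding vector sent in slot `t`. -/
def sent (P : PacketPlan K G) (F : Type) [Field F] (grp : (k : Fin K) → Fin (m k) → G)
    (s : ℕ → Finset (Fin K)) (t : ℕ) : Module.Dual F (Messages m F) :=
  P.innovative grp (P.evolve F grp s t) t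

variable (P : PacketPlan K G) (grp : (k : Fin K) → Fin (m k) → G)

lemma evolve_congr {s s' : ℕ → Finset (Fin K)} {t : ℕ} (h : ∀ τ < t, s τ = s' τ) :
    P.evolve F grp s t = P.evolve F grp s' t := by
  induction t with
  | zero => rfl
  | succ t ih =>
    simp only [evolve, ih fun τ hτ => h τ (by omega), h t (by omega)]

lemma sent_congr {s s' : ℕ → Finset (Fin K)} {t : ℕ} (h : ∀ τ < t, s τ = s' τ) :
    P.sent F grp s t = P.sent F grp s' t := by
  rw [sent, sent, P.evolve_congr grp h]

lemma valid_evolve (hF : (K : ℕ∞) < ENat.card F) (s : ℕ → Finset (Fin K)) (t : ℕ) :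
    (P.evolve F grp s t).Valid := by
  induction t with
  | zero => exact valid_init
  | succ t ih =>
    have := exists_valid_step _ ih (P.selectable_select grp _ t) hF
    rw [evolve, innovative, dif_pos this]
    exact this.choose_spec _

lemma obs_evolve_le (s : ℕ → Finset (Fin K)) (t : ℕ) (k : Fin K) :
    (P.evolve F grp s t).obs k ≤ Submodule.span F (P.sent F grp s '' {τ | τ < t ∧ k ∈ s τ}) := by
  induction t with
  | zero => simp [evolve, PacketState.init]
  | succ t ih =>
    have ih' := ih.trans (Submodule.span_mono
      (Set.image_mono (t := {τ | τ < t + 1 ∧ k ∈ s τ}) fun τ hτ => ⟨Nat.lt_succ_of_lt hτ.1, hτ.2⟩))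
    simp only [evolve, step]
    split_ifs with h
    · refine sup_le ih' (Submodule.span_mono (Set.singleton_subset_iff.2 ⟨t, ⟨by simp, h⟩, rfl⟩))
    · exact ih'

/-- A receiver whose packets are all finished can decode. -/
lemma eq_of_sent_eq (hF : (K : ℕ∞) < ENat.card F) {s : ℕ → Finset (Fin K)} {t : ℕ} {k : Fin K}
    (hfin : ∀ j, k ∈ (P.evolve F grp s t).heard k j) {X X' : Messages m F}
    (h : ∀ τ < t, k ∈ s τ → P.sent F grp s τ X = P.sent F grp s τ X') : X k = X' k := by
  have hle := ((P.valid_evolve grp hF s t).message_le k).trans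
    (sup_le (P.obs_evolve_le grp s t k) (by simp [hfin]))
  -- All received coding vectors vanish on `X - X'`; hence so do the coordinate functionals of
  -- session `k`, which lie in their span.
  have hker : Submodule.span F (P.sent F grp s '' {τ | τ < t ∧ k ∈ s τ}) ≤
      LinearMap.ker (Module.Dual.eval F (Messages m F) (X - X')) := by
    rw [Submodule.span_le]
    rintro _ ⟨τ, ⟨hτ, hk⟩, rfl⟩
    simp [h τ hτ hk]
  funext j
  have := hker (hle (Submodule.subset_span ⟨j, rfl⟩))
  simpa [symbolDual, sub_eq_zero] using this

/-- The number of packets of session `k` and group `g` with overhearing set `S`. -/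
def packetCount (st : PacketState m F) (k : Fin K) (g : G) (S : Finset (Fin K)) : ℕ :=
  ∑ j, if grp k j = g ∧ st.heard k j = S then 1 else 0

lemma packetCount_pos {grp : (k : Fin K) → Fin (m k) → G} {st : PacketState m F} {k : Fin K}
    {g : G} {S : Finset (Fin K)} :
    0 < packetCount grp st k g S ↔ ∃ j, grp k j = g ∧ st.heard k j = S := by
  rw [packetCount, Finset.sum_boole, Nat.cast_id, Finset.card_pos]
  simp [Finset.Nonempty]

lemma packetCount_le [DecidableEq G] (st : PacketState m F) (k : Fin K) (g : G)
    (S : Finset (Fin K)) :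
    packetCount grp st k g S ≤ (Finset.univ.filter fun j => grp k j = g).card := by
  rw [packetCount, Finset.card_filter]
  refine Finset.sum_le_sum fun j _ => ?_
  by_cases h : grp k j = g
  · simp only [h, true_and, if_true]; split_ifs <;> norm_num
  · simp [h]

/-- In slot `t` a packet leaves the overhearing set `S`. -/
def Leaves (F : Type) [Field F] (s : ℕ → Finset (Fin K)) (k : Fin K) (g : G) (S : Finset (Fin K))
    (t : ℕ) : Prop :=
  P.source t k = some (g, S) ∧ 0 < packetCount grp (P.evolve F grp s t) k g S ∧ ¬ s t ⊆ S

/-- In slot `t` a packet enters the overhearing set `S`. -/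
def Enters (F : Type) [Field F] (s : ℕ → Finset (Fin K)) (k : Fin K) (g : G) (S : Finset (Fin K))
    (t : ℕ) : Prop :=
  ∃ S₁, P.Leaves grp F s k g S₁ t ∧ P.phase t \ {k} ∪ s t = S

/-- At most one packet of a session moves in a slot. Departures stand on the left to avoid
subtraction in ℕ. -/
lemma packetCount_succ (s : ℕ → Finset (Fin K)) (k : Fin K) (g : G) (S : Finset (Fin K)) (t : ℕ) :
    packetCount grp (P.evolve F grp s (t + 1)) k g S + (if P.Leaves grp F s k g S t then 1 else 0) =
      packetCount grp (P.evolve F grp s t) k g S + if P.Enters grp F s k g S t then 1 else 0 := by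
  set st := P.evolve F grp s t with hst
  by_cases hmove : ∃ S₁, P.Leaves grp F s k g S₁ t
  · obtain ⟨S₁, hS₁⟩ := hmove
    obtain ⟨h1, h2, h3⟩ := id hS₁
    have hex : ∃ j, P.source t k = some (grp k j, st.heard k j) := by
      obtain ⟨j, rfl, rfl⟩ := packetCount_pos.1 h2
      exact ⟨j, h1⟩
    obtain ⟨j, hj⟩ : ∃ j, P.select grp st t k = some j := by simp [select, hex]
    have hsrc := select_eq_some hj
    rw [h1, Option.some_inj, Prod.mk.injEq] at hsrc
    have hstep : ∀ i, (P.evolve F grp s (t + 1)).heard k i =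
        if i = j then P.phase t \ {k} ∪ s t else st.heard k i := by
      intro i
      simp only [evolve, step, ← hst, hj, Option.some_inj]
      by_cases hij : j = i
      · subst hij; simp [← hsrc.2, h3]
      · simp [hij, Ne.symm hij]
    have hL : P.Leaves grp F s k g S t ↔ S₁ = S := by
      refine ⟨fun h => ?_, fun h => h ▸ hS₁⟩
      have := h1.symm.trans h.1
      simpa using this
    have hE : P.Enters grp F s k g S t ↔ P.phase t \ {k} ∪ s t = S :=
      ⟨fun ⟨_, _, h⟩ => h, fun h => ⟨S₁, hS₁, h⟩⟩
    simp only [packetCount, hstep, hL, hE]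
    rw [← Finset.add_sum_erase _ _ (Finset.mem_univ j),
      ← Finset.add_sum_erase _ _ (Finset.mem_univ j),
      Finset.sum_congr (g := fun i => if grp k i = g ∧ st.heard k i = S then 1 else 0) rfl]
    · simp only [if_true, ← hsrc.1, ← hsrc.2, true_and]
      ring
    · intro i hi
      rw [if_neg (Finset.ne_of_mem_erase hi)]
  · have hL : ¬ P.Leaves grp F s k g S t := fun h => hmove ⟨S, h⟩
    have hE : ¬ P.Enters grp F s k g S t := fun ⟨S₁, h, _⟩ => hmove ⟨S₁, h⟩
    rw [if_neg hL, if_neg hE]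
    simp only [packetCount, add_zero]
    refine Finset.sum_congr rfl fun i _ => if_congr (and_congr_right fun hi => ?_) rfl rfl
    have : ¬ (P.select grp st t k = some i ∧ ¬ s t ⊆ st.heard k i) := fun ⟨h, h'⟩ =>
      hmove ⟨st.heard k i, by rw [select_eq_some h, hi], packetCount_pos.2 ⟨i, hi, rfl⟩, h'⟩
    simp only [evolve, step, ← hst, if_neg this]

lemma packetCount_add (s : ℕ → Finset (Fin K)) (k : Fin K) (g : G) (S : Finset (Fin K)) {a b : ℕ}
    (hab : a ≤ b) :
    packetCount grp (P.evolve F grp s b) k g S +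
        ((Finset.Ico a b).filter (P.Leaves grp F s k g S)).card =
      packetCount grp (P.evolve F grp s a) k g S +
        ((Finset.Ico a b).filter (P.Enters grp F s k g S)).card := by
  induction b, hab using Nat.le_induction with
  | base => simp
  | succ b hab ih =>
    have := P.packetCount_succ (F := F) grp s k g S b
    have hI : Finset.Ico a (b + 1) = insert b (Finset.Ico a b) := by
      ext; simp; omega
    have hb : ∀ p : ℕ → Prop, ((Finset.Ico a (b + 1)).filter p).card =
        ((Finset.Ico a b).filter p).card + if p b then 1 else 0 := by
      intro p
      rw [hI, Finset.filter_insert]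
      split_ifs
      · rw [Finset.card_insert_of_notMem (by simp)]
      · rfl
    rw [hb, hb]
    omega

end PacketPlan
end

noncomputable section

open scoped Classical

/-! ### Schedules made of consecutive intervals -/

/-- The total length of the intervals that come before the interval `a`. -/
def intervalOffset {α : Type*} [Fintype α] (ρ : α → α → Prop) (f : α → ℕ) (a : α) : ℕ :=
  ∑ b with ρ b a, f b

lemma intervalOffset_add_le {α : Type*} [Fintype α] {ρ : α → α → Prop} [IsStrictOrder α ρ]
    (f : α → ℕ) {a b : α} (h : ρ a b) :
    intervalOffset ρ f a + f a ≤ intervalOffset ρ f b := by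
  rw [intervalOffset, add_comm, ← Finset.sum_insert (by simp [irrefl_of ρ a])]
  refine Finset.sum_le_sum_of_subset fun c hc => ?_
  simp only [Finset.mem_insert, Finset.mem_filter, Finset.mem_univ, true_and] at hc ⊢
  rcases hc with rfl | hc
  · exact h
  · exact trans_of ρ hc h

lemma intervalOffset_add_le_sum {α : Type*} [Fintype α] {ρ : α → α → Prop} [IsStrictOrder α ρ]
    (f : α → ℕ) (a : α) : intervalOffset ρ f a + f a ≤ ∑ b, f b := by
  rw [intervalOffset, add_comm, ← Finset.sum_insert (by simp [irrefl_of ρ a])]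
  exact Finset.sum_le_sum_of_subset (Finset.subset_univ _)

lemma union_sdiff_singleton {K : ℕ} {k : Fin K} {T : Finset (Fin K)} (hk : k ∉ T) : (T ∪ {k}) \ {k} = T := by
  ext a
  by_cases h : a = k <;> simp [h, hk]

/-- Consequently the block with `T = S` is the last one serving `S`, and every block that can feed
`S` lies in an earlier phase. -/
lemma order_of_ssubset {K : ℕ} {r : Finset (Fin K) → Finset (Fin K) → Prop}
    (hcard : CardCompatible r) {k : Fin K} {S T : Finset (Fin K)} (hS : S ⊆ {k}ᶜ) (hT : T ⊆ S)
    (hne : T ≠ S) : r (T ∪ {k}) (S ∪ {k}) := by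
  have hkS : k ∉ S := fun hk => by simpa using hS hk
  refine hcard _ _ (Finset.card_lt_card (Finset.ssubset_iff_subset_ne.2
    ⟨Finset.union_subset_union_left hT, fun h => hne ?_⟩))
  rw [← union_sdiff_singleton hkS, ← h, union_sdiff_singleton fun hk => hkS (hT hk)]

/-- Lengths of the phases and of the blocks inside the phases, for groups of packets that are
served one after the other. -/
structure PacketSchedule (K : ℕ) (G : Type) [LinearOrder G] where
  order : G → Finset (Fin K) → Finset (Fin K) → Prop
  isOrder : ∀ g, IsStrictTotalOrder (Finset (Fin K)) (order g)
  phaseLen : G → Finset (Fin K) → ℕ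
  blockLen : Fin K → G → Finset (Fin K) → Finset (Fin K) → ℕ
  blockLen_le : ∀ k g T, k ∉ T →
    ∑ S with T ⊆ S ∧ S ⊆ {k}ᶜ, blockLen k g S T ≤ phaseLen g (T ∪ {k})

namespace PacketSchedule

variable {K : ℕ} {G : Type} [LinearOrder G] (σ : PacketSchedule K G)

instance (g : G) : IsStrictTotalOrder (Finset (Fin K)) (σ.order g) := σ.isOrder g

/-- The order of the phases. -/
def phaseOrder (p q : G × Finset (Fin K)) : Prop :=
  p.1 < q.1 ∨ p.1 = q.1 ∧ σ.order p.1 p.2 q.2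

instance : IsStrictOrder (G × Finset (Fin K)) σ.phaseOrder where
  irrefl p h := by
    rcases h with h | ⟨-, h⟩
    · exact lt_irrefl _ h
    · exact irrefl_of (σ.order p.1) _ h
  trans := by
    rintro ⟨a, A⟩ ⟨b, B⟩ ⟨c, C⟩ (h | ⟨h, h'⟩) (i | ⟨i, i'⟩) <;> dsimp only at *
    · exact Or.inl (h.trans i)
    · subst i; exact Or.inl h
    · subst h; exact Or.inl i
    · subst h i; exact Or.inr ⟨rfl, trans_of (σ.order a) h' i'⟩

variable [Fintype G]

/-- The first slot of a phase. -/
def phaseStart (g : G) (T : Finset (Fin K)) : ℕ :=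
  intervalOffset σ.phaseOrder (fun p => σ.phaseLen p.1 p.2) (g, T)

/-- The number of slots of the schedule. -/
def total : ℕ := ∑ p : G × Finset (Fin K), σ.phaseLen p.1 p.2

/-- The first slot of the block in which packets of session `k` and group `g` with overhearing
set `S` are sent with coding set `T ∪ {k}`. -/
def blockStart (k : Fin K) (g : G) (S T : Finset (Fin K)) : ℕ :=
  σ.phaseStart g (T ∪ {k}) +
    -- Lengths outside `T ⊆ S ⊆ {k}ᶜ` are not controlled by `blockLen_le` and are masked to zero.
    intervalOffset (σ.order g) (fun S => if T ⊆ S ∧ S ⊆ {k}ᶜ then σ.blockLen k g S T else 0) S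

/-- The slot after the block. -/
def blockEnd (k : Fin K) (g : G) (S T : Finset (Fin K)) : ℕ :=
  σ.blockStart k g S T + σ.blockLen k g S T

variable {k : Fin K} {g g' : G} {S S' T T' : Finset (Fin K)}

lemma phaseStart_le_blockStart : σ.phaseStart g (T ∪ {k}) ≤ σ.blockStart k g S T :=
  Nat.le_add_right ..

lemma blockEnd_le_phaseEnd (hT : T ⊆ S) (hS : S ⊆ {k}ᶜ) :
    σ.blockEnd k g S T ≤ σ.phaseStart g (T ∪ {k}) + σ.phaseLen g (T ∪ {k}) := by
  have h := intervalOffset_add_le_sum (ρ := σ.order g)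
    (fun S => if T ⊆ S ∧ S ⊆ {k}ᶜ then σ.blockLen k g S T else 0) S
  have hk : k ∉ T := fun h => by simpa using hS (hT h)
  have h' := σ.blockLen_le k g T hk
  rw [Finset.sum_filter] at h'
  simp only [hT, hS, and_self, if_true] at h
  simp only [blockEnd, blockStart]
  omega

lemma phaseEnd_le_total : σ.phaseStart g T + σ.phaseLen g T ≤ σ.total :=
  intervalOffset_add_le_sum (ρ := σ.phaseOrder)
    (fun p : G × Finset (Fin K) => σ.phaseLen p.1 p.2) (g, T)

lemma phaseEnd_le_phaseStart (h : σ.phaseOrder (g, T) (g', T')) :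
    σ.phaseStart g T + σ.phaseLen g T ≤ σ.phaseStart g' T' :=
  intervalOffset_add_le (fun p : G × Finset (Fin K) => σ.phaseLen p.1 p.2) h

/-- The phases, and the blocks of one session inside a phase, follow each other in the order. -/
def Before (k : Fin K) (g : G) (T S T' S' : Finset (Fin K)) : Prop :=
  σ.order g (T ∪ {k}) (T' ∪ {k}) ∨ T = T' ∧ σ.order g S S'

lemma blockEnd_le_blockStart (hT : T ⊆ S) (hS : S ⊆ {k}ᶜ) (h : σ.Before k g T S T' S') :
    σ.blockEnd k g S T ≤ σ.blockStart k g S' T' := by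
  rcases h with h | ⟨rfl, h⟩
  · exact (σ.blockEnd_le_phaseEnd hT hS).trans
      ((σ.phaseEnd_le_phaseStart (g := g) (T := T ∪ {k}) (g' := g) (T' := T' ∪ {k}) (Or.inr ⟨rfl, h⟩)).trans σ.phaseStart_le_blockStart)
  · have := intervalOffset_add_le
      (fun S => if T ⊆ S ∧ S ⊆ {k}ᶜ then σ.blockLen k g S T else 0) h
    simp only [hT, hS, and_self, if_true] at this
    simp only [blockEnd, blockStart]
    omega

lemma phase_unique {t : ℕ} (h : σ.phaseStart g T ≤ t ∧ t < σ.phaseStart g T + σ.phaseLen g T)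
    (h' : σ.phaseStart g' T' ≤ t ∧ t < σ.phaseStart g' T' + σ.phaseLen g' T') :
    g = g' ∧ T = T' := by
  have h1 : ¬ σ.phaseOrder (g, T) (g', T') := fun hlt => by
    have := σ.phaseEnd_le_phaseStart hlt; omega
  have h2 : ¬ σ.phaseOrder (g', T') (g, T) := fun hlt => by
    have := σ.phaseEnd_le_phaseStart hlt; omega
  rcases lt_trichotomy g g' with hg | rfl | hg
  · exact absurd (Or.inl hg) h1
  · refine ⟨rfl, ?_⟩
    rcases trichotomous_of (σ.order g) T T' with hT | hT | hT
    · exact absurd (Or.inr ⟨rfl, hT⟩) h1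
    · exact hT
    · exact absurd (Or.inr ⟨rfl, hT⟩) h2
  · exact absurd (Or.inl hg) h2

/-- Slot `t` lies in the block. -/
def InBlock (k : Fin K) (g : G) (S T : Finset (Fin K)) (t : ℕ) : Prop :=
  T ⊆ S ∧ S ⊆ {k}ᶜ ∧ σ.blockStart k g S T ≤ t ∧ t < σ.blockEnd k g S T

lemma inPhase_of_inBlock {t : ℕ} (h : σ.InBlock k g S T t) :
    σ.phaseStart g (T ∪ {k}) ≤ t ∧ t < σ.phaseStart g (T ∪ {k}) + σ.phaseLen g (T ∪ {k}) :=
  ⟨σ.phaseStart_le_blockStart.trans h.2.2.1,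
    h.2.2.2.trans_le (σ.blockEnd_le_phaseEnd h.1 h.2.1)⟩

lemma InBlock.notMem {σ : PacketSchedule K G} {t : ℕ} (h : σ.InBlock k g S T t) :
    k ∉ S ∧ k ∉ T := by
  have : k ∉ S := fun hk => by simpa using h.2.1 hk
  exact ⟨this, fun hk => this (h.1 hk)⟩

/-- Phases are disjoint, and within a phase the blocks of one session are consecutive. Blocks of
different sessions may overlap, which is what allows mixing. -/
lemma block_unique {t : ℕ} (h : σ.InBlock k g S T t) (h' : σ.InBlock k g' S' T' t) :
    g = g' ∧ S = S' ∧ T = T' := by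
  obtain ⟨rfl, hT⟩ := σ.phase_unique (σ.inPhase_of_inBlock h) (σ.inPhase_of_inBlock h')
  obtain rfl : T = T' := by
    rw [← union_sdiff_singleton h.notMem.2, hT, union_sdiff_singleton h'.notMem.2]
  refine ⟨rfl, ?_, rfl⟩
  rcases trichotomous_of (σ.order g) S S' with hS | hS | hS
  · have := σ.blockEnd_le_blockStart h.1 h.2.1 (Or.inr ⟨rfl, hS⟩)
    have := h.2.2.2; have := h'.2.2.1; omega
  · exact hS
  · have := σ.blockEnd_le_blockStart h'.1 h'.2.1 (Or.inr ⟨rfl, hS⟩)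
    have := h'.2.2.2; have := h.2.2.1; omega

/-- The coding set of slot `t`. -/
def phaseAt (t : ℕ) : Finset (Fin K) :=
  if h : ∃ p : G × Finset (Fin K), σ.phaseStart p.1 p.2 ≤ t ∧
    t < σ.phaseStart p.1 p.2 + σ.phaseLen p.1 p.2 then h.choose.2 else ∅

lemma phaseAt_eq {t : ℕ} (h : σ.InBlock k g S T t) : σ.phaseAt t = T ∪ {k} := by
  have hex : ∃ p : G × Finset (Fin K), σ.phaseStart p.1 p.2 ≤ t ∧
    t < σ.phaseStart p.1 p.2 + σ.phaseLen p.1 p.2 := ⟨(g, T ∪ {k}), σ.inPhase_of_inBlock h⟩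
  rw [phaseAt, dif_pos hex]
  exact (σ.phase_unique hex.choose_spec (σ.inPhase_of_inBlock h)).2

/-- The packets of session `k` that are to be sent in slot `t`. -/
def sourceAt (t : ℕ) (k : Fin K) : Option (G × Finset (Fin K)) :=
  if h : ∃ q : G × Finset (Fin K) × Finset (Fin K), σ.InBlock k q.1 q.2.1 q.2.2 t then
    some (h.choose.1, h.choose.2.1) else none

lemma sourceAt_eq_some_iff {t : ℕ} :
    σ.sourceAt t k = some (g, S) ↔ ∃ T, σ.InBlock k g S T t := by
  unfold sourceAt
  split_ifs with h
  · have hs := h.choose_spec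
    constructor
    · intro he
      simp only [Option.some_inj, Prod.mk.injEq] at he
      exact ⟨h.choose.2.2, by rw [← he.1, ← he.2]; exact hs⟩
    · rintro ⟨T, hT⟩
      obtain ⟨h1, h2, -⟩ := σ.block_unique hs hT
      rw [h1, h2]
  · simp only [false_iff]
    rintro ⟨T, hT⟩
    exact h ⟨(g, S, T), hT⟩

/-- The plan that follows the schedule. -/
def plan : PacketPlan K G where
  phase := σ.phaseAt
  source := σ.sourceAt
  compatible t k g S h := by
    obtain ⟨T, hT⟩ := σ.sourceAt_eq_some_iff.1 h
    rw [σ.phaseAt_eq hT, union_sdiff_singleton hT.notMem.2]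
    exact ⟨by simp, hT.notMem.1, hT.1⟩

end PacketSchedule
end

noncomputable section

open scoped Classical

namespace PacketSchedule

open PacketPlan

/-! ### All packets finish if the blocks have typical receptions -/

variable {K : ℕ} {G : Type} [LinearOrder G] [Fintype G] (σ : PacketSchedule K G)

/-- The number of slots of the block in which the set of successful receivers lies in `𝒜`. -/
def hits (s : ℕ → Finset (Fin K)) (k : Fin K) (g : G) (S T : Finset (Fin K))
    (𝒜 : Finset (Finset (Fin K))) : ℕ :=
  ((Finset.Ico (σ.blockStart k g S T) (σ.blockEnd k g S T)).filter fun t => s t ∈ 𝒜).card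

/-- The receptions that move a packet from `S` to `S'` under the coding set `T ∪ {k}`. -/
def enterSet (S T S' : Finset (Fin K)) : Finset (Finset (Fin K)) := {A | ¬ A ⊆ S ∧ T ∪ A = S'}

/-- The receptions that remove a packet from `S`. -/
def leaveSet (S : Finset (Fin K)) : Finset (Finset (Fin K)) := {A | ¬ A ⊆ S}

/-- The blocks of session `k` that can move packets to `S`. -/
def entering (k : Fin K) (S : Finset (Fin K)) : Finset (Finset (Fin K) × Finset (Fin K)) :=
  {q | q.2 ⊆ q.1 ∧ q.1 ⊆ {k}ᶜ ∧ q.2 ⊆ S ∧ ¬ S ⊆ q.1}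

variable {σ} {m : Fin K → ℕ} {F : Type} [Field F] {grp : (k : Fin K) → Fin (m k) → G}
  {s : ℕ → Finset (Fin K)} {k : Fin K} {g : G} {S T : Finset (Fin K)}

lemma exists_inBlock_of_enters {t : ℕ} (h : σ.plan.Enters grp F s k g S t) :
    ∃ q ∈ entering k S, σ.InBlock k g q.1 q.2 t ∧ s t ∈ enterSet q.1 q.2 S := by
  obtain ⟨S₁, ⟨h1, -, h3⟩, h4⟩ := h
  obtain ⟨T₁, hT₁⟩ := σ.sourceAt_eq_some_iff.1 h1
  have hp : σ.plan.phase t \ {k} = T₁ := by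
    change σ.phaseAt t \ {k} = T₁
    rw [σ.phaseAt_eq hT₁, union_sdiff_singleton hT₁.notMem.2]
  rw [hp] at h4
  refine ⟨(S₁, T₁), ?_, hT₁, by simp [enterSet, h3, h4]⟩
  simp only [entering, Finset.mem_filter, Finset.mem_univ, true_and]
  refine ⟨hT₁.1, hT₁.2.1, h4 ▸ Finset.subset_union_left, fun h => h3 ?_⟩
  exact Finset.Subset.trans (h4 ▸ Finset.subset_union_right) h

lemma leaves_of_inBlock {t : ℕ} (h : σ.InBlock k g S T t)
    (hpos : 0 < packetCount grp (σ.plan.evolve F grp s t) k g S) (hs : s t ∈ leaveSet S) :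
    σ.plan.Leaves grp F s k g S t :=
  ⟨σ.sourceAt_eq_some_iff.2 ⟨T, h⟩, hpos, by simpa [leaveSet] using hs⟩

/-- Only an upper bound: a suitable reception moves nothing when the source set is empty. -/
lemma card_enters_le {a b : ℕ} {Q : Finset (Finset (Fin K) × Finset (Fin K))}
    (hQ : ∀ q ∈ entering k S, ∀ t, a ≤ t → t < b → σ.InBlock k g q.1 q.2 t → q ∈ Q) :
    ((Finset.Ico a b).filter (σ.plan.Enters grp F s k g S)).card ≤
      ∑ q ∈ Q, σ.hits s k g q.1 q.2 (enterSet q.1 q.2 S) := by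
  refine le_trans (Finset.card_le_card ?_) Finset.card_biUnion_le
  intro t ht
  rw [Finset.mem_filter, Finset.mem_Ico] at ht
  obtain ⟨q, hq, hqt, hs⟩ := exists_inBlock_of_enters ht.2
  exact Finset.mem_biUnion.2 ⟨q, hQ q hq t ht.1.1 ht.1.2 hqt,
    Finset.mem_filter.2 ⟨Finset.mem_Ico.2 hqt.2.2, hs⟩⟩

/-- As long as `S` is nonempty, each reception outside `S` during its blocks removes a packet; the
blocks are disjoint, so the counts add. -/
lemma sum_hits_le_card_leaves {a b : ℕ} {𝒯 : Finset (Finset (Fin K))} (hS : S ⊆ {k}ᶜ)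
    (h𝒯 : ∀ T ∈ 𝒯, T ⊆ S ∧ a ≤ σ.blockStart k g S T ∧ σ.blockEnd k g S T ≤ b ∧
      ∀ t, σ.InBlock k g S T t → 0 < packetCount grp (σ.plan.evolve F grp s t) k g S) :
    ∑ T ∈ 𝒯, σ.hits s k g S T (leaveSet S) ≤
      ((Finset.Ico a b).filter (σ.plan.Leaves grp F s k g S)).card := by
  have hin : ∀ T ∈ 𝒯, ∀ t ∈ (Finset.Ico (σ.blockStart k g S T) (σ.blockEnd k g S T)).filter
      (fun t => s t ∈ leaveSet S), σ.InBlock k g S T t := fun T hT t ht =>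
    ⟨(h𝒯 T hT).1, hS, Finset.mem_Ico.1 (Finset.mem_filter.1 ht).1⟩
  rw [show ∑ T ∈ 𝒯, σ.hits s k g S T (leaveSet S) = _ from (Finset.card_biUnion ?_).symm]
  · refine Finset.card_le_card fun t ht => ?_
    obtain ⟨T, hT, ht⟩ := Finset.mem_biUnion.1 ht
    have hb := hin T hT t ht
    obtain ⟨-, h2, h3, h4⟩ := h𝒯 T hT
    exact Finset.mem_filter.2 ⟨Finset.mem_Ico.2 ⟨h2.trans hb.2.2.1, hb.2.2.2.trans_le h3⟩,
      leaves_of_inBlock hb (h4 t hb) (Finset.mem_filter.1 ht).2⟩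
  · intro T hT T' hT' hne
    refine Finset.disjoint_left.2 fun t ht ht' => hne ?_
    exact (σ.block_unique (hin T hT t ht) (hin T' hT' t ht')).2.2

/-- During a block of `S` the session sends only from `S`, and a moved packet never lands in its old
set. A packet present at the end of the block therefore means that none of its slots was wasted. -/
lemma packetCount_blockEnd_le {t : ℕ} (h : σ.InBlock k g S T t) :
    packetCount grp (σ.plan.evolve F grp s (σ.blockEnd k g S T)) k g S ≤
      packetCount grp (σ.plan.evolve F grp s t) k g S := by
  have := σ.plan.packetCount_add (F := F) grp s k g S h.2.2.2.le
  rw [Finset.filter_false_of_mem (p := σ.plan.Enters grp F s k g S)] at this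
  · simp at this; omega
  · intro τ hτ he
    rw [Finset.mem_Ico] at hτ
    obtain ⟨q, hq, hqt, -⟩ := exists_inBlock_of_enters he
    obtain ⟨-, h2, -⟩ := σ.block_unique hqt (⟨h.1, h.2.1, h.2.2.1.trans hτ.1, hτ.2⟩ :
      σ.InBlock k g S T τ)
    simp [entering, h2] at hq

lemma blockEnd_le_last (hcard : CardCompatible (σ.order g)) (hS : S ⊆ {k}ᶜ) (hT : T ⊆ S) :
    σ.blockEnd k g S T ≤ σ.blockEnd k g S S := by
  by_cases h : T = S
  · rw [h]
  · exact (σ.blockEnd_le_blockStart hT hS (Or.inl (order_of_ssubset hcard hS hT h))).trans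
      (Nat.le_add_right _ _)

/-- If in every final segment of the relevant blocks at most as many receptions let packets enter
`S` as let packets leave `S`, then no packet is left in `S` after its last block. -/
lemma packetCount_eq_zero (hcard : CardCompatible (σ.order g)) (hS : S ⊆ {k}ᶜ)
    (h0 : packetCount grp (PacketState.init m F) k g S +
        ∑ q ∈ entering k S, σ.hits s k g q.1 q.2 (enterSet q.1 q.2 S) ≤
      ∑ T with T ⊆ S, σ.hits s k g S T (leaveSet S))
    (h1 : ∀ T₀, T₀ ⊆ S → T₀ ≠ S →
      ∑ q ∈ entering k S with σ.Before k g T₀ S q.2 q.1,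
          σ.hits s k g q.1 q.2 (enterSet q.1 q.2 S) ≤
        ∑ T with T ⊆ S ∧ σ.order g (T₀ ∪ {k}) (T ∪ {k}), σ.hits s k g S T (leaveSet S))
    {t : ℕ} (ht : σ.blockEnd k g S S ≤ t) :
    packetCount grp (σ.plan.evolve F grp s t) k g S = 0 := by
  have hend : packetCount grp (σ.plan.evolve F grp s (σ.blockEnd k g S S)) k g S = 0 := by
    by_contra hpos
    let E : Set (Finset (Fin K)) := {T | T ⊆ S ∧ T ≠ S ∧
      packetCount grp (σ.plan.evolve F grp s (σ.blockEnd k g S T)) k g S = 0}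
    have hstay : ∀ T, T ⊆ S → T ∉ E → ∀ t, σ.InBlock k g S T t →
        0 < packetCount grp (σ.plan.evolve F grp s t) k g S := by
      intro T hT hE t ht
      refine lt_of_lt_of_le (Nat.pos_of_ne_zero fun h => ?_) (packetCount_blockEnd_le ht)
      by_cases hTS : T = S
      · exact hpos (hTS ▸ h)
      · exact hE ⟨hT, hTS, h⟩
    by_cases hE : E.Nonempty
    · have wf : WellFounded fun T T' : Finset (Fin K) => σ.order g (T' ∪ {k}) (T ∪ {k}) := by
        have : IsStrictOrder (Finset (Fin K))
            (fun T T' : Finset (Fin K) => σ.order g (T' ∪ {k}) (T ∪ {k})) :=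
          { irrefl := fun T => irrefl_of (σ.order g) _
            trans := fun T₁ T₂ T₃ h h' => trans_of (σ.order g) h' h }
        exact Finite.wellFounded_of_trans_of_irrefl _
      -- The relation is reversed, so `T₀` is the latest block in `E`: after it, no service of `S`
      -- is wasted.
      obtain ⟨T₀, ⟨hT₀, hne, hz⟩, hmax⟩ := wf.has_min E hE
      have hadd := σ.plan.packetCount_add (F := F) grp s k g S
        (blockEnd_le_last hcard hS hT₀)
      have hent := card_enters_le (σ := σ) (F := F) (grp := grp) (s := s) (k := k) (g := g) (S := S)
        (a := σ.blockEnd k g S T₀) (b := σ.blockEnd k g S S)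
        (Q := (entering k S).filter fun q => σ.Before k g T₀ S q.2 q.1) (by
          rintro ⟨S₁, T₁⟩ hq t hat - hb
          refine Finset.mem_filter.2 ⟨hq, ?_⟩
          simp only [entering, Finset.mem_filter, Finset.mem_univ, true_and] at hq
          -- A feeding block with a slot after the end of the block of `T₀` cannot precede it; it is
          -- not a block of `S` either, so it comes later in the order.
          have hno : ¬ σ.Before k g T₁ S₁ T₀ S := fun h => by
            have h' := σ.blockEnd_le_blockStart hb.1 hb.2.1 h
            have h'' := hb.2.2.2
            simp only [blockEnd] at hat h' h''
            omega
          rcases trichotomous_of (σ.order g) (T₀ ∪ {k}) (T₁ ∪ {k}) with h | h | h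
          · exact Or.inl h
          · have hk : k ∉ T₀ := fun hk => by simpa using hS (hT₀ hk)
            have hTT : T₀ = T₁ := by
              rw [← union_sdiff_singleton hk, h, union_sdiff_singleton hb.notMem.2]
            rcases trichotomous_of (σ.order g) S S₁ with h' | h' | h'
            · exact Or.inr ⟨hTT, h'⟩
            · exact absurd h'.le hq.2.2.2
            · exact absurd (Or.inr ⟨hTT.symm, h'⟩) hno
          · exact absurd (Or.inl h) hno)
      have hlea := sum_hits_le_card_leaves (σ := σ) (F := F) (grp := grp) (s := s) (g := g) hS
        (a := σ.blockEnd k g S T₀) (b := σ.blockEnd k g S S)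
        (𝒯 := Finset.univ.filter fun T => T ⊆ S ∧ σ.order g (T₀ ∪ {k}) (T ∪ {k})) (by
          intro T hT
          simp only [Finset.mem_filter, Finset.mem_univ, true_and] at hT
          exact ⟨hT.1, σ.blockEnd_le_blockStart hT₀ hS (Or.inl hT.2),
            blockEnd_le_last hcard hS hT.1, hstay T hT.1 fun h => hmax T h hT.2⟩)
      have := h1 T₀ hT₀ hne
      omega
    -- No earlier block ends with `S` empty: count from slot 0 and include the initial packets.
    · have hadd := σ.plan.packetCount_add (F := F) grp s k g S
        (Nat.zero_le (σ.blockEnd k g S S))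
      have hent := card_enters_le (σ := σ) (F := F) (grp := grp) (s := s) (k := k) (g := g) (S := S)
        (a := 0) (b := σ.blockEnd k g S S) (Q := entering k S) fun q hq _ _ _ _ => hq
      have hlea := sum_hits_le_card_leaves (σ := σ) (F := F) (grp := grp) (s := s) (g := g) hS
        (a := 0) (b := σ.blockEnd k g S S)
        (𝒯 := Finset.univ.filter fun T => T ⊆ S) (by
          intro T hT
          simp only [Finset.mem_filter, Finset.mem_univ, true_and] at hT
          exact ⟨hT, Nat.zero_le _, blockEnd_le_last hcard hS hT,
            hstay T hT fun h => hE ⟨T, h⟩⟩)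
      rw [evolve] at hadd
      omega
  -- Nothing can enter `S` after its last block, so the count stays zero.
  have hadd := σ.plan.packetCount_add (F := F) grp s k g S ht
  rw [hend, Finset.filter_false_of_mem (p := σ.plan.Enters grp F s k g S)] at hadd
  · simp at hadd; omega
  · intro τ hτ he
    obtain ⟨⟨S₁, T₁⟩, hq, hb, -⟩ := exists_inBlock_of_enters he
    simp only [entering, Finset.mem_filter, Finset.mem_univ, true_and] at hq
    have := σ.blockEnd_le_blockStart (S' := S) hb.1 hb.2.1 (Or.inl (order_of_ssubset hcard hS hq.2.2.1
      fun h => hq.2.2.2 (h ▸ hq.1)))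
    have h' := hb.2.2.2
    rw [Finset.mem_Ico] at hτ
    simp only [blockEnd] at *
    omega

end PacketSchedule
end

noncomputable section

open scoped Classical

/-! ### From packet evolution to a feedback code -/

/-- A success pattern on `n` slots, continued by empty success sets. -/
def extendPattern {K n : ℕ} (s : Fin n → Finset (Fin K)) (t : ℕ) : Finset (Fin K) :=
  if h : t < n then s ⟨t, h⟩ else ∅

namespace PacketPlan

variable {K : ℕ} {G : Type} {m : Fin K → ℕ} {F : Type} [Field F] (P : PacketPlan K G)
  (grp : (k : Fin K) → Fin (m k) → G) {n n' : ℕ} (hdr : (Fin n' → Finset (Fin K)) → F)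

/-- The symbol sent in slot `t`: first the packets are sent as planned, then the success pattern is
announced. -/
def symbol (X : Messages m F) (s : ℕ → Finset (Fin K)) (t : ℕ) : F :=
  if t < n' then P.sent F grp s t X else hdr fun τ => s τ

lemma symbol_congr (X : Messages m F) {s s' : ℕ → Finset (Fin K)} {t : ℕ}
    (h : ∀ τ < t, s τ = s' τ) : P.symbol grp hdr X s t = P.symbol grp hdr X s' t := by
  unfold symbol
  split_ifs with ht
  · rw [P.sent_congr grp h]
  · congr 1
    funext τ
    exact h τ (by have := τ.2; omega)

/-- The success pattern that can be read off the channel outputs. -/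
def observedPattern {t : Fin n} (out : Set.Iio t → Fin K → Option F) (τ : ℕ) : Finset (Fin K) :=
  if h : τ < t then Finset.univ.filter fun k => out ⟨⟨τ, h.trans t.2⟩, h⟩ k ≠ none else ∅

/-- The code that follows the plan for `n'` slots and then announces the success pattern. -/
def code : FeedbackCode n m F where
  enc t X out := P.symbol grp hdr X (observedPattern out) t
  dec k y := if h : ∃ (X : Messages m F) (s : Fin n → Finset (Fin K)),
      ∀ t : Fin n, channelOutput (P.symbol grp hdr X (extendPattern s) t) (s t) k = y t
    then h.choose k else 0

/-- Erasures are visible as `none`, so the past outputs reveal the past success sets, and the symbol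
depends on no others. -/
lemma output_code (X : Messages m F) (s : Fin n → Finset (Fin K)) (t : Fin n) :
    (P.code grp hdr).output X s t =
      channelOutput (P.symbol grp hdr X (extendPattern s) t) (s t) := by
  have hout : ∀ t : Fin n, ∃ y, (P.code grp hdr).output X s t = channelOutput y (s t) := fun t =>
    ⟨_, by rw [FeedbackCode.output]⟩
  rw [FeedbackCode.output]
  congr 1
  refine P.symbol_congr grp hdr X fun τ hτ => ?_
  have hn : τ < n := hτ.trans t.2
  rw [observedPattern, dif_pos hτ, extendPattern, dif_pos hn]
  ext k
  obtain ⟨y, hy⟩ := hout ⟨τ, hn⟩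
  simp [hy, channelOutput]

lemma channelOutput_eq_iff {F : Type} {y y' : F} {S S' : Finset (Fin K)} {k : Fin K} :
    channelOutput y S k = channelOutput y' S' k ↔ (k ∈ S ↔ k ∈ S') ∧ (k ∈ S → y = y') := by
  unfold channelOutput
  by_cases h : k ∈ S <;> by_cases h' : k ∈ S' <;> simp [h, h']

/-- The decoder may pick any consistent pair. One received header forces the right pattern on the
first `n'` slots, hence the right coding vectors, and these determine `X k`. -/
lemma decoded_code (hF : (K : ℕ∞) < ENat.card F) (hhdr : Function.Injective hdr)
    {s : Fin n → Finset (Fin K)} {k : Fin K}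
    (hfin : ∀ j, k ∈ (P.evolve F grp (extendPattern s) n').heard k j)
    (hrec : ∃ t : Fin n, n' ≤ t ∧ k ∈ s t) (X : Messages m F) :
    (P.code grp hdr).decoded X s k = X k := by
  have hex : ∃ (X' : Messages m F) (s' : Fin n → Finset (Fin K)),
      ∀ t : Fin n, channelOutput (P.symbol grp hdr X' (extendPattern s') t) (s' t) k =
        (P.code grp hdr).output X s t k := ⟨X, s, fun t => by rw [output_code]⟩
  rw [FeedbackCode.decoded]
  change (if h : ∃ (X' : Messages m F) (s' : Fin n → Finset (Fin K)),
    ∀ t : Fin n, channelOutput (P.symbol grp hdr X' (extendPattern s') t) (s' t) k =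
        (P.code grp hdr).output X s t k then h.choose k else 0) = X k
  rw [dif_pos hex]
  obtain ⟨s', hs'⟩ := hex.choose_spec
  set X' := hex.choose
  simp only [output_code, channelOutput_eq_iff] at hs'
  obtain ⟨t₀, ht₀, hk₀⟩ := hrec
  have hpat : ∀ τ < n', extendPattern s τ = extendPattern s' τ := by
    have := (hs' t₀).2 ((hs' t₀).1.2 hk₀)
    rw [symbol, symbol, if_neg (by omega), if_neg (by omega)] at this
    intro τ hτ
    exact (congrFun (hhdr this) ⟨τ, hτ⟩).symm
  refine (P.eq_of_sent_eq grp hF hfin fun τ hτ hk => ?_).symm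
  have hτn : τ < n := by omega
  have h := hs' ⟨τ, hτn⟩
  have hk' : k ∈ s ⟨τ, hτn⟩ := by simpa [extendPattern, hτn] using hk
  have h2 := h.2 (h.1.2 hk')
  simp only [symbol, if_pos hτ] at h2
  rw [← h2, P.sent_congr grp fun τ' h' => hpat τ' (by omega)]

end PacketPlan

/-! ### Probabilities of success patterns: union bound and Chebyshev's inequality -/

namespace BroadcastPEC

variable {K : ℕ} (ch : BroadcastPEC K)

/-- The probability of a set of success patterns. -/
def patternProb {n : ℕ} (E : (Fin n → Finset (Fin K)) → Prop) : ℝ :=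
  ∑ s, (∏ t, ch.prob (s t)) * if E s then 1 else 0

lemma errorProb_le_patternProb {n : ℕ} {m : Fin K → ℕ} {F : Type} [Field F] [Fintype F]
    (c : FeedbackCode n m F) (k : Fin K) (E : (Fin n → Finset (Fin K)) → Prop)
    (hE : ∀ s, ¬ E s → ∀ X, c.decoded X s k = X k) : c.errorProb ch k ≤ ch.patternProb E := by
  have hcard : (0 : ℝ) < Fintype.card (Messages m F) := by exact_mod_cast Fintype.card_pos
  calc c.errorProb ch k
      ≤ ∑ X : Messages m F, (1 / (Fintype.card (Messages m F) : ℝ)) * ch.patternProb E := by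
        rw [FeedbackCode.errorProb]
        refine Finset.sum_le_sum fun X _ => ?_
        rw [patternProb, Finset.mul_sum]
        refine Finset.sum_le_sum fun s _ => ?_
        rw [mul_assoc]
        refine mul_le_mul_of_nonneg_left (mul_le_mul_of_nonneg_left ?_
          (Finset.prod_nonneg fun t _ => ch.prob_nonneg _)) (by positivity)
        by_cases h : E s
        · simp only [h, if_true]; split_ifs <;> norm_num
        · simp [h, hE s h X]
    _ = ch.patternProb E := by
        rw [Finset.sum_const, nsmul_eq_mul, Finset.card_univ]
        field_simp

lemma patternProb_mono {n : ℕ} {E E' : (Fin n → Finset (Fin K)) → Prop} (h : ∀ s, E s → E' s) :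
    ch.patternProb E ≤ ch.patternProb E' := by
  refine Finset.sum_le_sum fun s _ => mul_le_mul_of_nonneg_left ?_
    (Finset.prod_nonneg fun t _ => ch.prob_nonneg _)
  by_cases hs : E s
  · simp [hs, h s hs]
  · simp only [hs, if_false]; split_ifs <;> norm_num

lemma patternProb_exists_le {n : ℕ} {ι : Type*} [Fintype ι]
    (E : ι → (Fin n → Finset (Fin K)) → Prop) :
    ch.patternProb (fun s => ∃ i, E i s) ≤ ∑ i, ch.patternProb (E i) := by
  unfold patternProb
  rw [Finset.sum_comm]
  refine Finset.sum_le_sum fun s _ => ?_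
  rw [← Finset.mul_sum]
  refine mul_le_mul_of_nonneg_left ?_ (Finset.prod_nonneg fun t _ => ch.prob_nonneg _)
  split_ifs with h
  · obtain ⟨i, hi⟩ := h
    refine le_trans (by simp [hi])
      (Finset.single_le_sum (f := fun i => if E i s then (1 : ℝ) else 0) ?_ (Finset.mem_univ i))
    intro j _; split_ifs <;> norm_num
  · exact Finset.sum_nonneg fun j _ => by split_ifs <;> norm_num

/-- The mean of a product of functions of the single slots. -/
lemma sum_pattern_prod {n : ℕ} (f : Fin n → Finset (Fin K) → ℝ) :
    ∑ s : Fin n → Finset (Fin K), (∏ t, ch.prob (s t)) * ∏ t, f t (s t) =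
      ∏ t, ∑ A, ch.prob A * f t A := by
  rw [Finset.prod_univ_sum]
  simp [Finset.prod_mul_distrib]

/-- The probability that the set of successful receivers lies in `𝒜`. -/
def setProb (𝒜 : Finset (Finset (Fin K))) : ℝ := ∑ A ∈ 𝒜, ch.prob A

lemma setProb_nonneg (𝒜 : Finset (Finset (Fin K))) : 0 ≤ ch.setProb 𝒜 :=
  Finset.sum_nonneg fun A _ => ch.prob_nonneg A

lemma setProb_le_one (𝒜 : Finset (Finset (Fin K))) : ch.setProb 𝒜 ≤ 1 := by
  rw [← ch.sum_prob]
  exact Finset.sum_le_sum_of_subset_of_nonneg (Finset.subset_univ _)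
    fun A _ _ => ch.prob_nonneg A

/-- The centred indicator of `𝒜`. -/
def centred (𝒜 : Finset (Finset (Fin K))) (A : Finset (Fin K)) : ℝ :=
  (if A ∈ 𝒜 then 1 else 0) - ch.setProb 𝒜

lemma sum_prob_mul_centred (𝒜 : Finset (Finset (Fin K))) :
    ∑ A, ch.prob A * ch.centred 𝒜 A = 0 := by
  simp only [centred, mul_sub, Finset.sum_sub_distrib, ← Finset.sum_mul, ch.sum_prob]
  simp [setProb]

/-- Centred indicators of distinct slots are uncorrelated, and each has second moment at most 1. -/
lemma sum_pattern_sq_le {n : ℕ} (I : Finset (Fin n)) (𝒜 : Finset (Finset (Fin K))) :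
    ∑ s : Fin n → Finset (Fin K), (∏ t, ch.prob (s t)) *
      (∑ t ∈ I, ch.centred 𝒜 (s t)) ^ 2 ≤ n := by
  have hpair : ∀ t t' : Fin n, ∑ s : Fin n → Finset (Fin K), (∏ t, ch.prob (s t)) *
      (ch.centred 𝒜 (s t) * ch.centred 𝒜 (s t')) ≤ if t = t' then 1 else 0 := by
    intro t t'
    split_ifs with h
    · subst h
      have hone := ch.sum_pattern_prod (n := n) fun _ _ => 1
      simp only [Finset.prod_const_one, mul_one, ch.sum_prob] at hone
      rw [← hone]
      refine Finset.sum_le_sum fun s _ => mul_le_of_le_one_right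
        (Finset.prod_nonneg fun t _ => ch.prob_nonneg _) ?_
      have h0 := ch.setProb_nonneg 𝒜
      have h1 := ch.setProb_le_one 𝒜
      unfold centred
      split_ifs <;> nlinarith
    · have := ch.sum_pattern_prod fun u A => if u = t ∨ u = t' then ch.centred 𝒜 A else 1
      rw [Finset.prod_eq_zero (Finset.mem_univ t) (by simp [sum_prob_mul_centred])] at this
      refine le_of_eq (Eq.trans (Finset.sum_congr rfl fun s _ => ?_) this)
      congr 1
      rw [← Finset.prod_filter]
      have : (Finset.univ.filter fun u => u = t ∨ u = t') = {t, t'} := by ext; simp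
      rw [this, Finset.prod_pair h]
  simp only [sq, Finset.sum_mul_sum]
  simp only [Finset.mul_sum]
  rw [Finset.sum_comm]
  calc _ = ∑ t ∈ I, ∑ t' ∈ I, ∑ s : Fin n → Finset (Fin K), (∏ t, ch.prob (s t)) *
      (ch.centred 𝒜 (s t) * ch.centred 𝒜 (s t')) :=
        Finset.sum_congr rfl fun t _ => Finset.sum_comm
    _ ≤ ∑ t ∈ I, ∑ t' ∈ I, if t = t' then 1 else 0 :=
        Finset.sum_le_sum fun t _ => Finset.sum_le_sum fun t' _ => hpair t t'
    _ = I.card := by simp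
    _ ≤ n := by exact_mod_cast (Finset.card_le_univ I).trans (by simp)

/-- Chebyshev's inequality for the number of slots in `I` with success set in `𝒜`. -/
lemma patternProb_deviation_le {n : ℕ} (hn : 0 < n) (I : Finset (Fin n))
    (𝒜 : Finset (Finset (Fin K))) {δ : ℝ} (hδ : 0 < δ) :
    ch.patternProb (fun s : Fin n → Finset (Fin K) =>
      δ * n < |((I.filter fun t => s t ∈ 𝒜).card : ℝ) - I.card * ch.setProb 𝒜|) ≤
        1 / (δ ^ 2 * n) := by
  have hn' : (0 : ℝ) < n := by exact_mod_cast hn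
  have hsum : ∀ s : Fin n → Finset (Fin K), ∑ t ∈ I, ch.centred 𝒜 (s t) =
      ((I.filter fun t => s t ∈ 𝒜).card : ℝ) - I.card * ch.setProb 𝒜 := by
    intro s
    simp [centred, Finset.sum_sub_distrib]
  have : (δ * n) ^ 2 * ch.patternProb (fun s : Fin n → Finset (Fin K) =>
      δ * n < |((I.filter fun t => s t ∈ 𝒜).card : ℝ) - I.card * ch.setProb 𝒜|) ≤ n := by
    refine le_trans ?_ (ch.sum_pattern_sq_le I 𝒜)
    rw [patternProb, Finset.mul_sum]
    refine Finset.sum_le_sum fun s _ => ?_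
    rw [mul_left_comm]
    refine mul_le_mul_of_nonneg_left ?_ (Finset.prod_nonneg fun t _ => ch.prob_nonneg _)
    rw [hsum]
    split_ifs with h
    · rw [mul_one, ← sq_abs (_ - _)]
      exact pow_le_pow_left₀ (by positivity) h.le 2
    · rw [mul_zero]; positivity
  rw [le_div_iff₀ (by positivity)]
  nlinarith

end BroadcastPEC
end

noncomputable section

open scoped Classical

namespace BroadcastPEC

open PacketSchedule

variable {K : ℕ} (ch : BroadcastPEC K)

/-! ### The linear program -/

lemma setProb_leaveSet (S : Finset (Fin K)) : ch.setProb (leaveSet S) = ch.pUnion Sᶜ := by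
  rw [setProb, pUnion]
  refine Finset.sum_congr (Finset.ext fun A => ?_) fun _ _ => rfl
  simp only [leaveSet, Finset.mem_filter, Finset.mem_univ, true_and]
  simp [Finset.Nonempty, Finset.not_subset]

/-- `q.2 ∪ A = S` means `S \ q.2 ⊆ A ⊆ S`; then `A ⊄ q.1` is automatic from `q.2 ⊆ q.1` and `S ⊄
q.1`. -/
lemma setProb_enterSet {k : Fin K} {S : Finset (Fin K)} {q : Finset (Fin K) × Finset (Fin K)}
    (hq : q ∈ entering k S) : ch.setProb (enterSet q.1 q.2 S) = ch.fp (S \ q.2) Sᶜ := by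
  simp only [entering, Finset.mem_filter, Finset.mem_univ, true_and] at hq
  obtain ⟨h1, -, h3, h4⟩ := hq
  rw [setProb, fp]
  refine Finset.sum_congr (Finset.ext fun A => ?_) fun _ _ => rfl
  simp only [enterSet, Finset.mem_filter, Finset.mem_univ, true_and, Finset.compl_subset_compl]
  constructor
  · rintro ⟨-, rfl⟩
    refine ⟨fun a ha => ?_, Finset.subset_union_right⟩
    simp only [Finset.mem_sdiff, Finset.mem_union] at ha
    tauto
  · rintro ⟨h5, h6⟩
    have hS : q.2 ∪ A = S := by
      refine Finset.Subset.antisymm (Finset.union_subset h3 h6) fun a ha => ?_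
      by_cases h : a ∈ q.2
      · simp [h]
      · exact Finset.mem_union_right _ (h5 (by simp [ha, h]))
    exact ⟨fun h => h4 (hS ▸ Finset.union_subset h1 h), hS⟩

lemma pUnion_mono {S T : Finset (Fin K)} (h : S ⊆ T) : ch.pUnion S ≤ ch.pUnion T := by
  refine Finset.sum_le_sum_of_subset_of_nonneg (fun A hA => ?_) fun A _ _ => ch.prob_nonneg A
  simp only [Finset.mem_filter, Finset.mem_univ, true_and] at hA ⊢
  exact hA.mono (Finset.inter_subset_inter_left h)

lemma pUnion_nonneg (S : Finset (Fin K)) : 0 ≤ ch.pUnion S :=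
  Finset.sum_nonneg fun A _ => ch.prob_nonneg A

lemma fp_nonneg (S T : Finset (Fin K)) : 0 ≤ ch.fp S T :=
  Finset.sum_nonneg fun A _ => ch.prob_nonneg A

lemma fp_le_one (S T : Finset (Fin K)) : ch.fp S T ≤ 1 := by
  rw [← ch.sum_prob]
  exact Finset.sum_le_sum_of_subset_of_nonneg (Finset.subset_univ _)
    fun A _ _ => ch.prob_nonneg A

variable {ch} {r : Finset (Fin K) → Finset (Fin K) → Prop} {R : Fin K → ℝ}
  {x : Finset (Fin K) → ℝ} {w : Fin K → Finset (Fin K) → Finset (Fin K) → ℝ}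

/-- If receiver `k` never receives anything, then all mass that leaves some overhearing set enters
another one. -/
lemma sum_setProb_enterSet {k : Fin K} (hk : ch.pUnion {k} = 0) {S T : Finset (Fin K)}
    (hT : T ⊆ S) (hS : S ⊆ {k}ᶜ) :
    ∑ S' with S' ⊆ {k}ᶜ ∧ (S, T) ∈ entering k S', ch.setProb (enterSet S T S') =
      ch.pUnion Sᶜ := by
  have hzero : ∀ A, k ∈ A → ch.prob A = 0 := fun A hA =>
    (Finset.sum_eq_zero_iff_of_nonneg fun A _ => ch.prob_nonneg A).1 hk A (by
      simpa using ⟨k, by simpa using hA⟩)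
  have hkT : k ∉ T := fun h => by simpa using hS (hT h)
  rw [← setProb_leaveSet]
  simp only [setProb]
  rw [Finset.sum_sigma']
  -- Each `A` leads to the single target `T ∪ A`. Receptions containing `k`, whose target is not in
  -- `{k}ᶜ`, have probability zero.
  refine Finset.sum_bij_ne_zero (fun p _ _ => p.2) ?_ ?_ ?_ ?_
  · rintro ⟨S', A⟩ h -
    simp only [Finset.mem_sigma, enterSet, leaveSet, Finset.mem_filter, Finset.mem_univ,
      true_and] at h ⊢
    exact h.2.1
  · rintro ⟨S', A⟩ h - ⟨S'', A'⟩ h' - (rfl : A = A')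
    simp only [Finset.mem_sigma, enterSet, Finset.mem_filter, Finset.mem_univ, true_and] at h h'
    rw [Sigma.mk.injEq]
    exact ⟨h.2.2.symm.trans h'.2.2, HEq.rfl⟩
  · intro A hA hne
    have hkA : k ∉ A := fun h => hne (hzero A h)
    simp only [leaveSet, Finset.mem_filter, Finset.mem_univ, true_and] at hA
    refine ⟨⟨T ∪ A, A⟩, ?_, hne, rfl⟩
    simp only [Finset.mem_sigma, enterSet, entering, Finset.mem_filter, Finset.mem_univ, true_and]
    refine ⟨⟨?_, hT, hS, Finset.subset_union_left,
      fun h => hA (Finset.Subset.trans Finset.subset_union_right h)⟩, hA, trivial⟩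
    intro a ha
    simp only [Finset.mem_compl, Finset.mem_singleton]
    rintro rfl
    simp [hkT, hkA] at ha
  · intros; rfl

end BroadcastPEC

namespace InnerFeasible

open PacketSchedule BroadcastPEC

variable {K : ℕ} {ch : BroadcastPEC K} {r : Finset (Fin K) → Finset (Fin K) → Prop}
  {R : Fin K → ℝ} {x : Finset (Fin K) → ℝ} {w : Fin K → Finset (Fin K) → Finset (Fin K) → ℝ}

/-- With no packet ever finishing, total inflow over all `S` equals total outflow. Nothing flows
into `∅`, and clean-up bounds the inflow of every other `S` by its outflow, so the outflow of `∅`,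
and with it the rate, is at most 0. -/
lemma rate_nonpos (h : InnerFeasible ch r R x w) {k : Fin K} (hk : ch.pUnion {k} = 0) :
    R k ≤ 0 := by
  have hflow : ∑ S with S ⊆ {k}ᶜ, ∑ q ∈ entering k S, w k q.1 q.2 * ch.fp (S \ q.2) Sᶜ =
      ∑ S with S ⊆ {k}ᶜ, (∑ T with T ⊆ S, w k S T) * ch.pUnion Sᶜ := by
    calc _ = ∑ S with S ⊆ {k}ᶜ, ∑ q with q.2 ⊆ q.1 ∧ q.1 ⊆ {k}ᶜ,
          if q ∈ entering k S then w k q.1 q.2 * ch.setProb (enterSet q.1 q.2 S) else 0 := by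
          refine Finset.sum_congr rfl fun S _ => ?_
          rw [← Finset.sum_filter]
          refine Finset.sum_congr ?_ fun q hq => ?_
          · ext q
            simp only [entering, Finset.mem_filter, Finset.mem_univ, true_and]
            tauto
          · rw [setProb_enterSet ch (Finset.mem_filter.1 hq).2]
      _ = ∑ q : Finset (Fin K) × Finset (Fin K) with q.2 ⊆ q.1 ∧ q.1 ⊆ {k}ᶜ,
          w k q.1 q.2 * ch.pUnion q.1ᶜ := by
          rw [Finset.sum_comm]
          refine Finset.sum_congr rfl fun q hq => ?_
          simp only [Finset.mem_filter, Finset.mem_univ, true_and] at hq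
          rw [← sum_setProb_enterSet hk hq.1 hq.2, Finset.mul_sum, ← Finset.sum_filter,
            Finset.filter_filter]
      _ = _ := by
          simp only [Finset.sum_mul, Finset.sum_filter, Fintype.sum_prod_type]
          refine Finset.sum_congr rfl fun S _ => ?_
          by_cases hS : S ⊆ {k}ᶜ <;> simp [hS]
  have hmem : (∅ : Finset (Fin K)) ∈ Finset.univ.filter fun S : Finset (Fin K) => S ⊆ {k}ᶜ := by
    simp
  rw [← Finset.add_sum_erase _ _ hmem, ← Finset.add_sum_erase _ _ hmem] at hflow
  have hle : ∑ S ∈ (Finset.univ.filter fun S : Finset (Fin K) => S ⊆ {k}ᶜ).erase ∅,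
      ∑ q ∈ entering k S, w k q.1 q.2 * ch.fp (S \ q.2) Sᶜ ≤
      ∑ S ∈ (Finset.univ.filter fun S : Finset (Fin K) => S ⊆ {k}ᶜ).erase ∅,
        (∑ T with T ⊆ S, w k S T) * ch.pUnion Sᶜ := by
    refine Finset.sum_le_sum fun S hS => ?_
    simp only [Finset.mem_erase, Finset.mem_filter, Finset.mem_univ, true_and] at hS
    exact h.clean_up k S hS.2 hS.1
  have hempty : entering k (∅ : Finset (Fin K)) = ∅ := by simp [entering]
  have hrate := h.rate k
  have hsub : (Finset.univ.filter fun T : Finset (Fin K) => T ⊆ ∅) = {∅} := by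
    ext; simp [Finset.subset_empty]
  rw [hempty, Finset.sum_empty, hsub, Finset.sum_singleton, Finset.compl_empty] at hflow
  linarith

/-- The inequalities scale. -/
lemma smul (h : InnerFeasible ch r R x w) {c : ℝ} (h0 : 0 ≤ c) (h1 : c ≤ 1) :
    InnerFeasible ch r (fun k => c * R k) (fun S => c * x S) (fun k S T => c * w k S T) where
  x_nonneg S := mul_nonneg h0 (h.x_nonneg S)
  w_nonneg k S T hT hS := mul_nonneg h0 (h.w_nonneg k S T hT hS)
  total := by
    rw [← Finset.mul_sum]
    exact (mul_le_of_le_one_left (Finset.sum_nonneg fun S _ => h.x_nonneg S) h1).trans_lt h.total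
  coding_len T k hk := by
    rw [← Finset.mul_sum]
    exact mul_le_mul_of_nonneg_left (h.coding_len T k hk) h0
  rate k := by
    rw [mul_assoc]
    exact mul_le_mul_of_nonneg_left (h.rate k) h0
  clean_up k S hS hne := by
    simp only [mul_assoc, ← Finset.mul_sum]
    exact mul_le_mul_of_nonneg_left (h.clean_up k S hS hne) h0
  causality k S T hT hS hne := by
    simp only [mul_assoc, ← Finset.mul_sum, ← mul_add]
    exact mul_le_mul_of_nonneg_left (h.causality k S T hT hS hne) h0

end InnerFeasible

/-- The inequalities that the lengths of the blocks of a schedule have to satisfy: packets leave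
each overhearing set strictly faster than they enter it, in all final segments of the blocks. -/
structure StrictlyFeasible {K : ℕ} (ch : BroadcastPEC K)
    (r : Finset (Fin K) → Finset (Fin K) → Prop) (R : Fin K → ℝ)
    (x : Finset (Fin K) → ℝ) (w : Fin K → Finset (Fin K) → Finset (Fin K) → ℝ) : Prop where
  x_nonneg : ∀ S, 0 ≤ x S
  w_nonneg : ∀ k S T, T ⊆ S → S ⊆ {k}ᶜ → 0 ≤ w k S T
  coding_len : ∀ k T, k ∉ T → ∑ S with T ⊆ S ∧ S ⊆ {k}ᶜ, w k S T ≤ x (T ∪ {k})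
  rate : ∀ k, 0 < ch.pUnion {k} → R k < w k ∅ ∅ * ch.pUnion Finset.univ
  clean_up : ∀ k, 0 < ch.pUnion {k} → ∀ S : Finset (Fin K), S ⊆ {k}ᶜ → S ≠ ∅ →
    ∑ q ∈ PacketSchedule.entering k S, w k q.1 q.2 * ch.fp (S \ q.2) Sᶜ <
      (∑ T with T ⊆ S, w k S T) * ch.pUnion Sᶜ
  late : ∀ k, 0 < ch.pUnion {k} → ∀ S T : Finset (Fin K), T ⊆ S → S ⊆ {k}ᶜ → T ≠ S →
    ∑ q ∈ PacketSchedule.entering k S with r (T ∪ {k}) (q.2 ∪ {k}) ∨ T = q.2 ∧ r S q.1,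
        w k q.1 q.2 * ch.fp (S \ q.2) Sᶜ <
      (∑ T₁ with T₁ ⊆ S ∧ r (T ∪ {k}) (T₁ ∪ {k}), w k S T₁) * ch.pUnion Sᶜ

/-! ### From the linear program to strict inequalities -/

namespace InnerFeasible

open PacketSchedule BroadcastPEC

variable {K : ℕ} {ch : BroadcastPEC K} {r : Finset (Fin K) → Finset (Fin K) → Prop}
  {R : Fin K → ℝ} {x : Finset (Fin K) → ℝ} {w : Fin K → Finset (Fin K) → Finset (Fin K) → ℝ}

lemma union_singleton_inj {k : Fin K} {T T' : Finset (Fin K)} (hT : k ∉ T) (hT' : k ∉ T')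
    (h : T ∪ {k} = T' ∪ {k}) : T = T' := by
  rw [← union_sdiff_singleton hT, h, union_sdiff_singleton hT']

/-- The strict clean-up inequality and causality bound what happens after any given block. -/
lemma late_of_causality [IsStrictTotalOrder (Finset (Fin K)) r] (hr : CardCompatible r)
    (w_nonneg : ∀ k S T, T ⊆ S → S ⊆ {k}ᶜ → 0 ≤ w k S T) {k : Fin K} {S T : Finset (Fin K)}
    (hT : T ⊆ S) (hS : S ⊆ {k}ᶜ)
    (hclean : ∑ q ∈ entering k S, w k q.1 q.2 * ch.fp (S \ q.2) Sᶜ <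
      (∑ T with T ⊆ S, w k S T) * ch.pUnion Sᶜ)
    (hcaus : (w k S T + ∑ T₁ with T₁ ⊆ S ∧ r (T₁ ∪ {k}) (T ∪ {k}), w k S T₁) * ch.pUnion Sᶜ
      ≤ (∑ S₁ with r S₁ S ∧ T ⊆ S₁ ∧ S₁ ⊆ {k}ᶜ, w k S₁ T * ch.fp (S \ T) Sᶜ)
        + ∑ q : Finset (Fin K) × Finset (Fin K) with
            q.2 ⊆ q.1 ∧ q.1 ⊆ {k}ᶜ ∧ r (q.2 ∪ {k}) (T ∪ {k}) ∧ q.2 ⊆ S ∧ ¬ S ⊆ q.1,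
          w k q.1 q.2 * ch.fp (S \ q.2) Sᶜ) :
    ∑ q ∈ entering k S with r (T ∪ {k}) (q.2 ∪ {k}) ∨ T = q.2 ∧ r S q.1,
        w k q.1 q.2 * ch.fp (S \ q.2) Sᶜ <
      (∑ T₁ with T₁ ⊆ S ∧ r (T ∪ {k}) (T₁ ∪ {k}), w k S T₁) * ch.pUnion Sᶜ := by
  have hkS : k ∉ S := fun hk => by simpa using hS hk
  have hout : ∑ T₁ with T₁ ⊆ S, w k S T₁ =
      (w k S T + ∑ T₁ with T₁ ⊆ S ∧ r (T₁ ∪ {k}) (T ∪ {k}), w k S T₁) +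
        ∑ T₁ with T₁ ⊆ S ∧ r (T ∪ {k}) (T₁ ∪ {k}), w k S T₁ := by
    rw [← Finset.sum_insert (by simp [irrefl_of r]), ← Finset.sum_union]
    · refine Finset.sum_congr (Finset.ext fun T₁ => ?_) fun _ _ => rfl
      simp only [Finset.mem_union, Finset.mem_insert, Finset.mem_filter, Finset.mem_univ, true_and]
      constructor
      · intro h
        rcases trichotomous_of r (T₁ ∪ {k}) (T ∪ {k}) with h' | h' | h'
        · exact Or.inl (Or.inr ⟨h, h'⟩)
        · exact Or.inl (Or.inl (union_singleton_inj (fun hk => hkS (h hk))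
            (fun hk => hkS (hT hk)) h'))
        · exact Or.inr ⟨h, h'⟩
      · rintro ((rfl | h) | h)
        exacts [hT, h.1, h.1]
    · rw [Finset.disjoint_left]
      intro T₁ h h'
      simp only [Finset.mem_insert, Finset.mem_filter, Finset.mem_univ, true_and] at h h'
      rcases h with rfl | h
      · exact irrefl_of r _ h'.2
      · exact irrefl_of r _ (trans_of r h.2 h'.2)
  -- The two causality sums run over disjoint sets of blocks feeding `S`, none of them later than
  -- the block of `T`. In the first sum `r S₁ S` rules out `S ⊆ S₁` by cardinality.
  have hin : (∑ S₁ with r S₁ S ∧ T ⊆ S₁ ∧ S₁ ⊆ {k}ᶜ, w k S₁ T * ch.fp (S \ T) Sᶜ)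
        + ∑ q : Finset (Fin K) × Finset (Fin K) with
            q.2 ⊆ q.1 ∧ q.1 ⊆ {k}ᶜ ∧ r (q.2 ∪ {k}) (T ∪ {k}) ∧ q.2 ⊆ S ∧ ¬ S ⊆ q.1,
          w k q.1 q.2 * ch.fp (S \ q.2) Sᶜ ≤
      ∑ q ∈ entering k S with ¬ (r (T ∪ {k}) (q.2 ∪ {k}) ∨ T = q.2 ∧ r S q.1),
        w k q.1 q.2 * ch.fp (S \ q.2) Sᶜ := by
    have hmap : ∑ S₁ with r S₁ S ∧ T ⊆ S₁ ∧ S₁ ⊆ {k}ᶜ, w k S₁ T * ch.fp (S \ T) Sᶜ =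
        ∑ q ∈ (Finset.univ.filter fun S₁ => r S₁ S ∧ T ⊆ S₁ ∧ S₁ ⊆ {k}ᶜ).map
          (Function.Embedding.sectL (Finset (Fin K)) T),
          w k q.1 q.2 * ch.fp (S \ q.2) Sᶜ := by
      rw [Finset.sum_map]
      rfl
    rw [hmap, ← Finset.sum_union]
    · refine Finset.sum_le_sum_of_subset_of_nonneg (fun q hq => ?_) fun q hq _ => ?_
      · simp only [entering, Finset.mem_union, Finset.mem_map, Finset.mem_filter, Finset.mem_univ,
          true_and] at hq ⊢
        rcases hq with ⟨S₁, ⟨h1, h2, h3⟩, rfl⟩ | ⟨h1, h2, h3, h4, h5⟩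
        · refine ⟨⟨h2, h3, hT, fun h => ?_⟩, ?_⟩
          · by_cases hSS : S = S₁
            · subst hSS; exact irrefl_of r _ h1
            · exact irrefl_of r _ (trans_of r h1 (hr _ _ (Finset.card_lt_card
                (Finset.ssubset_iff_subset_ne.2 ⟨h, hSS⟩))))
          · rintro (h | h)
            · exact irrefl_of r _ h
            · exact irrefl_of r _ (trans_of r h1 h.2)
        · refine ⟨⟨h1, h2, h4, h5⟩, ?_⟩
          rintro (h | h)
          · exact irrefl_of r _ (trans_of r h h3)
          · rw [h.1] at h3
            exact irrefl_of r _ h3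
      · simp only [entering, Finset.mem_filter, Finset.mem_univ, true_and] at hq
        exact mul_nonneg (w_nonneg _ _ _ hq.1.1 hq.1.2.1) (ch.fp_nonneg _ _)
    · rw [Finset.disjoint_left]
      intro q h h'
      simp only [Finset.mem_map, Finset.mem_filter, Finset.mem_univ, true_and] at h h'
      obtain ⟨S₁, -, rfl⟩ := h
      exact irrefl_of r _ h'.2.2.1
  have hsplit := Finset.sum_filter_add_sum_filter_not (entering k S)
    (fun q => r (T ∪ {k}) (q.2 ∪ {k}) ∨ T = q.2 ∧ r S q.1)
    (fun q => w k q.1 q.2 * ch.fp (S \ q.2) Sᶜ)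
  rw [hout, add_mul] at hclean
  linarith

/-- Slightly longer last blocks make the inequalities strict. -/
lemma exists_strictlyFeasible [IsStrictTotalOrder (Finset (Fin K)) r] (hr : CardCompatible r)
    (h : InnerFeasible ch r R x w) {η : ℝ} (hη : 0 < η) :
    ∃ x' w', StrictlyFeasible ch r R x' w' ∧ ∑ S, x' S ≤ ∑ S, x S + η := by
  -- At most `2 ^ K` lengthened blocks feed `S`, all from smaller sets. A factor `C` per element
  -- makes the extra service of `S` exceed their total extra inflow.
  obtain ⟨C, hC1, hC⟩ : ∃ C : ℝ, 1 ≤ C ∧ ∀ k, 0 < ch.pUnion {k} → 2 ^ K < C * ch.pUnion {k} := by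
    refine ⟨1 + ∑ k, 2 ^ K / ch.pUnion {k}, ?_, fun k hk => ?_⟩
    · have : 0 ≤ ∑ k, 2 ^ K / ch.pUnion {k} :=
        Finset.sum_nonneg fun k _ => div_nonneg (by positivity) (ch.pUnion_nonneg _)
      linarith
    · have : 2 ^ K / ch.pUnion {k} ≤ ∑ k, 2 ^ K / ch.pUnion {k} :=
        Finset.single_le_sum (f := fun k => 2 ^ K / ch.pUnion {k})
          (fun k _ => div_nonneg (by positivity) (ch.pUnion_nonneg _)) (Finset.mem_univ k)
      have h2 : 2 ^ K / ch.pUnion {k} < 1 + ∑ k, 2 ^ K / ch.pUnion {k} := by linarith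
      exact (div_lt_iff₀ hk).1 h2
  have hC0 : 0 < C := by linarith
  -- Each of the `2 ^ K` phases grows by `e * C ^ K`, in total exactly `η`.
  set e : ℝ := η / (2 ^ K * C ^ K) with he
  have he0 : 0 < e := by positivity
  have hadd0 : ∀ S : Finset (Fin K), 0 < e * C ^ S.card := fun S => by positivity
  -- Only the block `T = S`, the last one of `S`, grows: the left sides of causality are unchanged
  -- and the right sides can only increase.
  let w' : Fin K → Finset (Fin K) → Finset (Fin K) → ℝ := fun k S T =>
    w k S T + if S = T then e * C ^ S.card else 0
  have hw' : ∀ k S T, T ⊆ S → S ⊆ {k}ᶜ → 0 ≤ w' k S T := fun k S T hT hS => by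
    have := h.w_nonneg k S T hT hS
    have := (hadd0 S).le
    simp only [w']
    split_ifs <;> linarith
  have hle : ∀ k S T, w k S T ≤ w' k S T := fun k S T => by
    have := (hadd0 S).le
    simp only [w']
    split_ifs <;> linarith
  have hclean : ∀ k, 0 < ch.pUnion {k} → ∀ S : Finset (Fin K), S ⊆ {k}ᶜ → S ≠ ∅ →
      ∑ q ∈ entering k S, w' k q.1 q.2 * ch.fp (S \ q.2) Sᶜ <
        (∑ T with T ⊆ S, w' k S T) * ch.pUnion Sᶜ := by
    intro k hk S hS hne
    obtain ⟨c, hc⟩ : ∃ c, S.card = c + 1 :=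
      Nat.exists_eq_succ_of_ne_zero (by simpa using hne)
    have hin : ∑ q ∈ entering k S, w' k q.1 q.2 * ch.fp (S \ q.2) Sᶜ ≤
        ∑ q ∈ entering k S, w k q.1 q.2 * ch.fp (S \ q.2) Sᶜ + 2 ^ K * (e * C ^ c) := by
      have hextra : ∑ q ∈ (entering k S).filter (fun q => q.1 = q.2),
          e * C ^ q.1.card * ch.fp (S \ q.2) Sᶜ ≤ 2 ^ K * (e * C ^ c) := by
        calc _ ≤ ∑ q ∈ (entering k S).filter (fun q => q.1 = q.2), e * C ^ c := by
              refine Finset.sum_le_sum fun q hq => ?_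
              simp only [entering, Finset.mem_filter, Finset.mem_univ, true_and] at hq
              refine (mul_le_of_le_one_right (hadd0 _).le (ch.fp_le_one _ _)).trans ?_
              refine mul_le_mul_of_nonneg_left (pow_le_pow_right₀ hC1 ?_) he0.le
              have hlt : q.1.card < S.card := Finset.card_lt_card
                (Finset.ssubset_iff_subset_ne.2 ⟨hq.2 ▸ hq.1.2.2.1, fun h => hq.1.2.2.2 h.symm.subset⟩)
              omega
          _ ≤ 2 ^ K * (e * C ^ c) := by
              rw [Finset.sum_const, nsmul_eq_mul]
              refine mul_le_mul_of_nonneg_right ?_ (by positivity)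
              have : ((entering k S).filter fun q => q.1 = q.2).card ≤
                  (Finset.univ : Finset (Finset (Fin K))).card := by
                refine Finset.card_le_card_of_injOn Prod.fst (by simp) ?_
                rintro ⟨a, b⟩ ha ⟨a', b'⟩ ha' (rfl : a = a')
                have h1 := (Finset.mem_filter.1 ha).2
                have h2 := (Finset.mem_filter.1 ha').2
                dsimp only at h1 h2
                rw [← h1, ← h2]
              rw [Finset.card_univ, Fintype.card_finset, Fintype.card_fin] at this
              exact_mod_cast this
      rw [Finset.sum_filter] at hextra
      simp only [w', add_mul, Finset.sum_add_distrib, ite_mul, zero_mul]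
      linarith
    have hout : ∑ T with T ⊆ S, w' k S T = ∑ T with T ⊆ S, w k S T + e * C ^ (c + 1) := by
      simp only [w', Finset.sum_add_distrib]
      rw [Finset.sum_ite_eq, if_pos (by simp), hc]
    have hp : ch.pUnion {k} ≤ ch.pUnion Sᶜ := ch.pUnion_mono fun a ha => by
      rw [Finset.mem_singleton] at ha
      subst ha
      exact Finset.mem_compl.2 fun h => by simpa using hS h
    have h1 := h.clean_up k S hS hne
    have h2 : 2 ^ K * (e * C ^ c) < e * C ^ (c + 1) * ch.pUnion Sᶜ := by
      calc 2 ^ K * (e * C ^ c) < C * ch.pUnion {k} * (e * C ^ c) :=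
            mul_lt_mul_of_pos_right (hC k hk) (by positivity)
        _ = e * C ^ (c + 1) * ch.pUnion {k} := by ring
        _ ≤ _ := mul_le_mul_of_nonneg_left hp (by positivity)
    rw [hout, add_mul]
    refine hin.trans_lt ?_
    have h1' : ∑ q ∈ entering k S, w k q.1 q.2 * ch.fp (S \ q.2) Sᶜ ≤
      (∑ T with T ⊆ S, w k S T) * ch.pUnion Sᶜ := h1
    linarith
  refine ⟨fun S => x S + e * C ^ K, w', ⟨fun S => ?_, hw', fun k T hT => ?_, fun k hk => ?_,
    hclean, fun k hk S T hT hS hne => ?_⟩, ?_⟩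
  · have := h.x_nonneg S
    positivity
  · have h1 := h.coding_len (T ∪ {k}) k (by simp)
    rw [union_sdiff_singleton hT] at h1
    simp only [w', Finset.sum_add_distrib]
    rw [Finset.sum_ite_eq']
    have h2 : e * C ^ T.card ≤ e * C ^ K :=
      mul_le_mul_of_nonneg_left (pow_le_pow_right₀ hC1 (by simpa using T.card_le_univ)) he0.le
    have := (hadd0 T).le
    split_ifs <;> linarith
  · have h1 := h.rate k
    have h2 : 0 < ch.pUnion Finset.univ := hk.trans_le (ch.pUnion_mono (Finset.subset_univ _))
    have h3 := mul_pos (hadd0 ∅) h2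
    simp only [w', if_true, add_mul]
    linarith
  · refine late_of_causality hr hw' hT hS (hclean k hk S hS fun h0 => hne ?_) ?_
    · subst h0; exact Finset.subset_empty.1 hT
    have hss : r (T ∪ {k}) (S ∪ {k}) := order_of_ssubset hr hS hT hne
    have hL : w' k S T + ∑ T₁ with T₁ ⊆ S ∧ r (T₁ ∪ {k}) (T ∪ {k}), w' k S T₁ =
        w k S T + ∑ T₁ with T₁ ⊆ S ∧ r (T₁ ∪ {k}) (T ∪ {k}), w k S T₁ := by
      congr 1
      · simp [w', hne.symm]
      · refine Finset.sum_congr rfl fun T₁ h₁ => ?_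
        simp only [Finset.mem_filter, Finset.mem_univ, true_and] at h₁
        have : S ≠ T₁ := by
          rintro rfl
          exact irrefl_of r _ (trans_of r h₁.2 hss)
        simp [w', this]
    rw [hL]
    refine (h.causality k S T hT hS hne).trans (add_le_add ?_ ?_)
    · exact Finset.sum_le_sum fun S₁ _ => mul_le_mul_of_nonneg_right (hle _ _ _) (ch.fp_nonneg _ _)
    · exact Finset.sum_le_sum fun q _ => mul_le_mul_of_nonneg_right (hle _ _ _) (ch.fp_nonneg _ _)
  · rw [Finset.sum_add_distrib, Finset.sum_const, Finset.card_univ, Fintype.card_finset,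
      Fintype.card_fin, nsmul_eq_mul, he]
    push_cast
    refine le_of_eq ?_
    field_simp

end InnerFeasible
end

noncomputable section

open scoped Classical

/-! ### Achievability -/

lemma exists_uniform_gap {ι : Type*} [Finite ι] {p : ι → Prop} {a b : ι → ℝ}
    (h : ∀ i, p i → a i < b i) : ∃ μ > 0, ∀ i, p i → a i + μ ≤ b i := by
  have : ∀ᶠ μ in nhdsWithin (0 : ℝ) (Set.Ioi 0), ∀ i, p i → a i + μ ≤ b i := by
    refine Filter.eventually_all.2 fun i => ?_
    by_cases hp : p i
    · have h0 : 0 < b i - a i := sub_pos.2 (h i hp)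
      filter_upwards [Ioo_mem_nhdsGT h0] with μ hμ _
      linarith [hμ.2]
    · simp [hp]
  obtain ⟨μ, hμ, h0⟩ := (this.and self_mem_nhdsWithin).exists
  exact ⟨μ, h0, hμ⟩

lemma exists_fiber_card_le {G : Type} [Fintype G] [DecidableEq G] {N : ℕ} {c : G → ℕ} (h : N ≤ ∑ g, c g) :
    ∃ f : Fin N → G, ∀ g, (Finset.univ.filter fun j => f j = g).card ≤ c g := by
  obtain ⟨e⟩ : Nonempty (Fin N ↪ Σ g, Fin (c g)) :=
    Function.Embedding.nonempty_of_card_le (by simpa using h)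
  refine ⟨fun j => (e j).1, fun g => ?_⟩
  calc _ ≤ (Finset.univ.map (Function.Embedding.sigmaMk (β := fun g => Fin (c g)) g)).card := by
        refine Finset.card_le_card_of_injOn e (fun j hj => ?_) e.injective.injOn
        simp only [Finset.coe_filter, Finset.mem_univ, true_and, Set.mem_ofPred_eq] at hj
        subst hj
        simp
    _ = c g := by simp

/-! ### Typical success patterns -/

namespace PacketSchedule

variable {K : ℕ} {G : Type} [LinearOrder G] [Fintype G] (σ : PacketSchedule K G)

/-- The slots of a block, or for `none` the slots after the end of the schedule. -/
def slots (n : ℕ) : Option (Fin K × G × Finset (Fin K) × Finset (Fin K)) → Finset (Fin n)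
  | some (k, g, S, T) => {t | σ.blockStart k g S T ≤ t ∧ t < σ.blockEnd k g S T}
  | none => {t | σ.total ≤ t}

/-- In each block, and after the end of the schedule, all sets of receptions occur about as often
as expected. -/
def Typical (ch : BroadcastPEC K) {n : ℕ} (δ : ℝ) (s : Fin n → Finset (Fin K)) : Prop :=
  ∀ i 𝒜, |(((σ.slots n i).filter fun t => s t ∈ 𝒜).card : ℝ) -
    (σ.slots n i).card * ch.setProb 𝒜| ≤ δ * n

lemma patternProb_not_typical_le (ch : BroadcastPEC K) {n : ℕ} (hn : 0 < n) {δ : ℝ} (hδ : 0 < δ) :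
    ch.patternProb (fun s : Fin n → Finset (Fin K) => ¬ σ.Typical ch δ s) ≤
      Fintype.card (Option (Fin K × G × Finset (Fin K) × Finset (Fin K)) ×
        Finset (Finset (Fin K))) * (1 / (δ ^ 2 * n)) := by
  refine (ch.patternProb_mono (E' := fun s => ∃ q : Option (Fin K × G × Finset (Fin K) ×
    Finset (Fin K)) × Finset (Finset (Fin K)), δ * n <
      |(((σ.slots n q.1).filter fun t => s t ∈ q.2).card : ℝ) -
        (σ.slots n q.1).card * ch.setProb q.2|) fun s hs => ?_).trans ?_
  · simp only [Typical, not_forall, not_le] at hs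
    obtain ⟨i, 𝒜, h⟩ := hs
    exact ⟨(i, 𝒜), h⟩
  · refine (ch.patternProb_exists_le _).trans ?_
    refine (Finset.sum_le_sum fun q _ => ch.patternProb_deviation_le hn _ q.2 hδ).trans ?_
    rw [Finset.sum_const, nsmul_eq_mul, Finset.card_univ]

variable {σ} {ch : BroadcastPEC K} {n : ℕ} {s : Fin n → Finset (Fin K)} {δ : ℝ} {k : Fin K} {g : G}
  {S T : Finset (Fin K)}

lemma hits_extendPattern (h : σ.blockEnd k g S T ≤ n) (𝒜 : Finset (Finset (Fin K))) :
    σ.hits (extendPattern s) k g S T 𝒜 =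
      ((σ.slots n (some (k, g, S, T))).filter fun t => s t ∈ 𝒜).card := by
  rw [hits, ← Finset.card_map Fin.valEmbedding]
  congr 1
  ext t
  simp only [slots, Finset.mem_filter, Finset.mem_Ico, Finset.mem_map, Finset.mem_univ, true_and,
    Fin.valEmbedding_apply]
  constructor
  · rintro ⟨⟨h1, h2⟩, h3⟩
    have ht : t < n := by omega
    rw [extendPattern, dif_pos ht] at h3
    exact ⟨⟨t, ht⟩, ⟨⟨h1, h2⟩, h3⟩, rfl⟩
  · rintro ⟨u, ⟨h1, h2⟩, rfl⟩
    refine ⟨h1, ?_⟩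
    rwa [extendPattern, dif_pos u.2]

lemma card_slots (h : σ.blockEnd k g S T ≤ n) :
    (σ.slots n (some (k, g, S, T))).card = σ.blockLen k g S T := by
  rw [← Finset.card_map Fin.valEmbedding]
  have : (σ.slots n (some (k, g, S, T))).map Fin.valEmbedding =
      Finset.Ico (σ.blockStart k g S T) (σ.blockEnd k g S T) := by
    ext t
    simp only [slots, Finset.mem_filter, Finset.mem_Ico, Finset.mem_map, Finset.mem_univ, true_and,
      Fin.valEmbedding_apply]
    constructor
    · rintro ⟨u, h, rfl⟩; exact h
    · intro h'; exact ⟨⟨t, by omega⟩, h', rfl⟩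
  rw [this, Nat.card_Ico, blockEnd]
  omega

lemma blockEnd_le_total (hT : T ⊆ S) (hS : S ⊆ {k}ᶜ) : σ.blockEnd k g S T ≤ σ.total :=
  (σ.blockEnd_le_phaseEnd hT hS).trans σ.phaseEnd_le_total

lemma Typical.abs_hits_sub_le (hs : σ.Typical ch δ s) (hn : σ.total ≤ n) (hT : T ⊆ S)
    (hS : S ⊆ {k}ᶜ) (𝒜 : Finset (Finset (Fin K))) :
    |(σ.hits (extendPattern s) k g S T 𝒜 : ℝ) - σ.blockLen k g S T * ch.setProb 𝒜| ≤ δ * n := by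
  have h := (σ.blockEnd_le_total (g := g) hT hS).trans hn
  rw [hits_extendPattern h, ← card_slots h]
  exact hs _ _

/-- At least `n * θ` slots follow the schedule; if `k` received none of them, the deviation would be
at least `n * θ * ch.pUnion {k} > δ * n`. -/
lemma Typical.exists_header (hs : σ.Typical ch δ s) {θ : ℝ} (hn : (σ.total : ℝ) ≤ n * (1 - θ))
    (hn0 : 0 < n) (hδ : δ < θ * ch.pUnion {k}) (hk : 0 < ch.pUnion {k}) :
    ∃ t : Fin n, σ.total ≤ t ∧ k ∈ s t := by
  have hn0' : (0 : ℝ) < n := by exact_mod_cast hn0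
  have h := hs none {A | k ∈ A}
  have hp : ch.setProb {A | k ∈ A} = ch.pUnion {k} := by
    rw [BroadcastPEC.setProb, BroadcastPEC.pUnion]
    refine Finset.sum_congr (Finset.ext fun A => ?_) fun _ _ => rfl
    simp [Finset.Nonempty]
  have hc : (n : ℝ) * θ ≤ (σ.slots n none).card := by
    have h1 : n ≤ (σ.slots n none).card + σ.total := by
      have h2 := Finset.card_filter_add_card_filter_not (s := (Finset.univ : Finset (Fin n)))
        (p := fun t => σ.total ≤ t)
      have h3 : (Finset.univ.filter fun t : Fin n => ¬ σ.total ≤ t).card ≤ σ.total := by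
        rw [← Finset.card_map Fin.valEmbedding]
        calc _ ≤ (Finset.range σ.total).card := Finset.card_le_card fun t ht => by
              simp only [Finset.mem_map, Finset.mem_filter, Finset.mem_univ, true_and] at ht
              obtain ⟨u, hu, rfl⟩ := ht
              simpa using hu
          _ = σ.total := Finset.card_range _
      rw [Finset.card_univ, Fintype.card_fin] at h2
      change n ≤ (Finset.univ.filter fun t : Fin n => σ.total ≤ t).card + _
      omega
    have h1' : (n : ℝ) ≤ (σ.slots n none).card + σ.total := by exact_mod_cast h1
    linarith
  rw [hp] at h
  have hpos : 0 < ((σ.slots n none).filter fun t => s t ∈ Finset.univ.filter (k ∈ ·)).card := by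
    rw [Nat.pos_iff_ne_zero]
    intro h0
    rw [h0, Nat.cast_zero, zero_sub, abs_neg] at h
    have h1 := (le_abs_self _).trans h
    nlinarith [mul_le_mul_of_nonneg_right hc hk.le]
  obtain ⟨t, ht⟩ := Finset.card_pos.1 hpos
  simp only [slots, Finset.mem_filter, Finset.mem_univ, true_and] at ht
  exact ⟨t, ht⟩

/-- On typical success patterns the numbers of receptions inherit a strict linear inequality
between the lengths of the blocks. -/
lemma Typical.hits_balance (hs : σ.Typical ch δ s) (hn : σ.total ≤ n) (hS : S ⊆ {k}ᶜ)
    {w : Finset (Fin K) → Finset (Fin K) → ℝ} {μ c : ℝ} {a : ℕ}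
    (hw0 : ∀ S T, T ⊆ S → S ⊆ {k}ᶜ → 0 ≤ w S T)
    (hw : ∀ S T, σ.blockLen k g S T = ⌊(n : ℝ) * w S T⌋₊)
    (hδ : δ = μ / (4 * (4 : ℝ) ^ K)) (hμ : 4 * (4 : ℝ) ^ K ≤ μ * n) (ha : a ≤ n * c + 1)
    {Q : Finset (Finset (Fin K) × Finset (Fin K))} (hQ : Q ⊆ entering k S)
    {𝒯 : Finset (Finset (Fin K))} (h𝒯 : ∀ T ∈ 𝒯, T ⊆ S)
    (h : c + ∑ q ∈ Q, w q.1 q.2 * ch.fp (S \ q.2) Sᶜ + μ ≤ (∑ T ∈ 𝒯, w S T) * ch.pUnion Sᶜ) :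
    a + ∑ q ∈ Q, σ.hits (extendPattern s) k g q.1 q.2 (enterSet q.1 q.2 S) ≤
      ∑ T ∈ 𝒯, σ.hits (extendPattern s) k g S T (leaveSet S) := by
  have hn0 : (0 : ℝ) ≤ n := Nat.cast_nonneg n
  have hD : (1 : ℝ) ≤ 4 ^ K := one_le_pow₀ (by norm_num)
  have hδn : 4 * (4 : ℝ) ^ K * (δ * n) = μ * n := by rw [hδ]; field_simp
  have hδ0 : 0 ≤ δ * n := by
    by_contra hneg
    have : 4 * (4 : ℝ) ^ K * (δ * n) < 0 := mul_neg_of_pos_of_neg (by positivity) (not_le.1 hneg)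
    linarith
  have hcardQ : (Q.card : ℝ) ≤ 4 ^ K := by
    have : Q.card ≤ (2 ^ K) * (2 ^ K) := by simpa using Finset.card_le_univ Q
    rw [← mul_pow] at this
    exact_mod_cast this
  have hcard𝒯 : (𝒯.card : ℝ) ≤ 4 ^ K := by
    have h1 : 𝒯.card ≤ 2 ^ K := by simpa using Finset.card_le_univ 𝒯
    have h2 : 2 ^ K ≤ 4 ^ K := Nat.pow_le_pow_left (by norm_num) K
    exact_mod_cast h1.trans h2
  have hupper : ∑ q ∈ Q, (σ.hits (extendPattern s) k g q.1 q.2 (enterSet q.1 q.2 S) : ℝ) ≤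
      n * ∑ q ∈ Q, w q.1 q.2 * ch.fp (S \ q.2) Sᶜ + 4 ^ K * (δ * n) := by
    calc _ ≤ ∑ q ∈ Q, (n * (w q.1 q.2 * ch.fp (S \ q.2) Sᶜ) + δ * n) := by
          refine Finset.sum_le_sum fun q hq => ?_
          have hq' := hQ hq
          have hq'' := hq'
          simp only [entering, Finset.mem_filter, Finset.mem_univ, true_and] at hq''
          have h1 := (abs_le.1 (hs.abs_hits_sub_le (g := g) hn hq''.1 hq''.2.1
            (enterSet q.1 q.2 S))).2
          rw [ch.setProb_enterSet hq', hw] at h1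
          have h2 := Nat.floor_le (mul_nonneg hn0 (hw0 _ _ hq''.1 hq''.2.1))
          have h3 := mul_le_mul_of_nonneg_right h2 (ch.fp_nonneg (S \ q.2) Sᶜ)
          linarith
      _ ≤ _ := by
          rw [Finset.sum_add_distrib, ← Finset.mul_sum, Finset.sum_const, nsmul_eq_mul]
          have := mul_le_mul_of_nonneg_right hcardQ hδ0
          linarith
  have hlower : n * ((∑ T ∈ 𝒯, w S T) * ch.pUnion Sᶜ) - 4 ^ K * (1 + δ * n) ≤
      ∑ T ∈ 𝒯, (σ.hits (extendPattern s) k g S T (leaveSet S) : ℝ) := by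
    calc _ ≤ ∑ T ∈ 𝒯, (n * (w S T * ch.pUnion Sᶜ) - (1 + δ * n)) := by
          rw [Finset.sum_sub_distrib, ← Finset.mul_sum, ← Finset.sum_mul, Finset.sum_const,
            nsmul_eq_mul]
          have := mul_le_mul_of_nonneg_right hcard𝒯 (show 0 ≤ 1 + δ * n by linarith)
          linarith
      _ ≤ _ := by
          refine Finset.sum_le_sum fun T hT => ?_
          have h1 := (abs_le.1 (hs.abs_hits_sub_le (g := g) hn (h𝒯 T hT) hS (leaveSet S))).1
          have hp1 := ch.setProb_le_one (leaveSet S)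
          rw [ch.setProb_leaveSet] at h1 hp1
          rw [hw] at h1
          have h2 := (Nat.lt_floor_add_one (n * w S T)).le
          have h3 := mul_le_mul_of_nonneg_right h2 (ch.pUnion_nonneg Sᶜ)
          linarith
  have h' := mul_le_mul_of_nonneg_left h hn0
  -- Error budget: the deviations cost `2 * 4 ^ K * δ * n = μ * n / 2`, the floors at most `4 ^ K ≤
  -- μ * n / 4`, and the rounding of `a` at most `1 ≤ μ * n / 4`.
  have : (a : ℝ) + ∑ q ∈ Q, (σ.hits (extendPattern s) k g q.1 q.2 (enterSet q.1 q.2 S) : ℝ) ≤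
      ∑ T ∈ 𝒯, (σ.hits (extendPattern s) k g S T (leaveSet S) : ℝ) := by
    nlinarith
  exact_mod_cast this

end PacketSchedule
end

noncomputable section

open scoped Classical

open PacketSchedule PacketPlan

/-- The schedule of `n` times the lengths `x` and `w`, rounded down. -/
def scaledSchedule {K : ℕ} {ch : BroadcastPEC K} {G : Type} [LinearOrder G]
    {r : G → Finset (Fin K) → Finset (Fin K) → Prop} {R : G → Fin K → ℝ}
    {x : G → Finset (Fin K) → ℝ} {w : G → Fin K → Finset (Fin K) → Finset (Fin K) → ℝ}
    (hr : ∀ g, IsStrictTotalOrder (Finset (Fin K)) (r g))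
    (h : ∀ g, StrictlyFeasible ch (r g) (R g) (x g) (w g)) (n : ℕ) : PacketSchedule K G where
  order := r
  isOrder := hr
  phaseLen g S := ⌊(n : ℝ) * x g S⌋₊
  blockLen k g S T := ⌊(n : ℝ) * w g k S T⌋₊
  blockLen_le k g T hT := by
    refine Nat.le_floor ?_
    push_cast
    refine le_trans (Finset.sum_le_sum fun S hS => Nat.floor_le ?_) ?_
    · simp only [Finset.mem_filter, Finset.mem_univ, true_and] at hS
      exact mul_nonneg (Nat.cast_nonneg n) ((h g).w_nonneg k S T hS.1 hS.2)
    · rw [← Finset.mul_sum]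
      exact mul_le_mul_of_nonneg_left ((h g).coding_len k T hT) (Nat.cast_nonneg n)

/-- Groups of packets with strictly feasible block lengths can be served one after the other. -/
theorem achievable_of_strictlyFeasible {K : ℕ} {ch : BroadcastPEC K} {G : Type} [Fintype G]
    [LinearOrder G] {r : G → Finset (Fin K) → Finset (Fin K) → Prop} {R : G → Fin K → ℝ}
    {x : G → Finset (Fin K) → ℝ} {w : G → Fin K → Finset (Fin K) → Finset (Fin K) → ℝ}
    (hr : ∀ g, IsStrictTotalOrder (Finset (Fin K)) (r g)) (hcard : ∀ g, CardCompatible (r g))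
    (h : ∀ g, StrictlyFeasible ch (r g) (R g) (x g) (w g)) (hR : ∀ g k, 0 ≤ R g k)
    (hR0 : ∀ k, ch.pUnion {k} = 0 → ∑ g, R g k = 0) (htotal : ∑ g, ∑ S, x g S < 1) :
    ch.Achievable fun k => ∑ g, R g k := by
  refine ⟨fun k => Finset.sum_nonneg fun g _ => hR g k, fun ε hε => ?_⟩
  obtain ⟨μ₁, hμ₁, hrate⟩ := exists_uniform_gap
    (ι := G × Fin K) (p := fun i => 0 < ch.pUnion {i.2})
    (fun i hi => (h i.1).rate i.2 hi)
  obtain ⟨μ₂, hμ₂, hclean⟩ := exists_uniform_gap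
    (ι := G × Fin K × Finset (Fin K))
    (p := fun i => 0 < ch.pUnion {i.2.1} ∧ i.2.2 ⊆ {i.2.1}ᶜ ∧ i.2.2 ≠ ∅)
    (fun i hi => (h i.1).clean_up i.2.1 hi.1 i.2.2 hi.2.1 hi.2.2)
  obtain ⟨μ₃, hμ₃, hlate⟩ := exists_uniform_gap
    (ι := G × Fin K × Finset (Fin K) × Finset (Fin K))
    (p := fun i => 0 < ch.pUnion {i.2.1} ∧ i.2.2.2 ⊆ i.2.2.1 ∧ i.2.2.1 ⊆ {i.2.1}ᶜ ∧
      i.2.2.2 ≠ i.2.2.1)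
    (fun i hi => (h i.1).late i.2.1 hi.1 i.2.2.1 i.2.2.2 hi.2.1 hi.2.2.1 hi.2.2.2)
  -- The fraction of slots left over for the header.
  set θ : ℝ := 1 - ∑ g, ∑ S, x g S with hθ
  have hθ0 : 0 < θ := by linarith
  obtain ⟨μ₄, hμ₄, hhead⟩ := exists_uniform_gap (ι := Fin K) (p := fun k => 0 < ch.pUnion {k})
    (a := fun _ => 0) (b := fun k => θ * ch.pUnion {k}) (fun k hk => mul_pos hθ0 hk)
  set μ : ℝ := min (min μ₁ μ₂) (min μ₃ μ₄) with hμdef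
  have hμ : 0 < μ := lt_min (lt_min hμ₁ hμ₂) (lt_min hμ₃ hμ₄)
  have hle₁ : μ ≤ μ₁ := (min_le_left _ _).trans (min_le_left _ _)
  have hle₂ : μ ≤ μ₂ := (min_le_left _ _).trans (min_le_right _ _)
  have hle₃ : μ ≤ μ₃ := (min_le_right _ _).trans (min_le_left _ _)
  have hle₄ : μ ≤ μ₄ := (min_le_right _ _).trans (min_le_right _ _)
  set δ : ℝ := μ / (4 * (4 : ℝ) ^ K) with hδ
  have hD : (1 : ℝ) ≤ 4 ^ K := one_le_pow₀ (by norm_num)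
  have hδ0 : 0 < δ := by positivity
  have hδμ : δ < μ := div_lt_self hμ (by linarith)
  set J : ℝ := ((Fintype.card (Option (Fin K × G × Finset (Fin K) × Finset (Fin K)) ×
        Finset (Finset (Fin K))) : ℕ) : ℝ) with hJ
  obtain ⟨N, hN⟩ := exists_nat_gt (max (4 * (4 : ℝ) ^ K / μ) (J / (δ ^ 2 * ε)))
  refine ⟨N + 1, fun n hn => ?_⟩
  have hnN : (N : ℝ) ≤ n := by exact_mod_cast (by omega : N ≤ n)
  have hn0 : 0 < n := by omega
  have hn0' : (0 : ℝ) < n := by exact_mod_cast hn0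
  have hn1 : 4 * (4 : ℝ) ^ K ≤ μ * n := by
    have := ((le_max_left _ _).trans_lt hN).trans_le hnN
    rw [div_lt_iff₀ hμ] at this
    linarith
  have hn2 : J * (1 / (δ ^ 2 * n)) < ε := by
    have := ((le_max_right _ _).trans_lt hN).trans_le hnN
    rw [div_lt_iff₀ (by positivity)] at this
    rw [mul_one_div, div_lt_iff₀ (by positivity)]
    linarith
  set σ := scaledSchedule hr h n with hσ
  have hσtotal : (σ.total : ℝ) ≤ n * (1 - θ) := by
    rw [total, hθ, sub_sub_cancel, Finset.mul_sum, Fintype.sum_prod_type]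
    push_cast
    refine Finset.sum_le_sum fun g _ => ?_
    rw [Finset.mul_sum]
    exact Finset.sum_le_sum fun S _ => Nat.floor_le (mul_nonneg hn0'.le ((h g).x_nonneg S))
  have hσn : σ.total ≤ n := by
    have : (σ.total : ℝ) ≤ n := hσtotal.trans (mul_le_of_le_one_right hn0'.le (by linarith))
    exact_mod_cast this
  -- `⌈n ∑ R g k⌉ ≤ ∑ ⌈n R g k⌉`, so the symbols can be divided among the groups.
  have hgrp : ∀ k, ∃ f : Fin ⌈(n : ℝ) * ∑ g, R g k⌉₊ → G,
      ∀ g, (Finset.univ.filter fun j => f j = g).card ≤ ⌈(n : ℝ) * R g k⌉₊ := by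
    intro k
    refine exists_fiber_card_le (c := fun g => ⌈(n : ℝ) * R g k⌉₊) (Nat.ceil_le.2 ?_)
    push_cast
    rw [Finset.mul_sum]
    exact Finset.sum_le_sum fun g _ => Nat.le_ceil _
  choose grp hgrp using hgrp
  -- `K + 1` elements for the innovative mixes; one element per success pattern for the header.
  refine ⟨max (K + 1) (Fintype.card (Fin σ.total → Finset (Fin K))), fun F _ _ hF => ?_⟩
  have hFK : (K : ℕ∞) < ENat.card F := by
    rw [ENat.card_eq_coe_fintype_card]
    exact_mod_cast (le_max_left _ _).trans hF
  obtain ⟨hdr⟩ : Nonempty ((Fin σ.total → Finset (Fin K)) ↪ F) :=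
    Function.Embedding.nonempty_of_card_le ((le_max_right _ _).trans hF)
  refine ⟨σ.plan.code grp hdr, fun k => ?_⟩
  refine ((ch.errorProb_le_patternProb _ k (fun s => ¬ σ.Typical ch δ s) ?_).trans
    (σ.patternProb_not_typical_le ch hn0 hδ0)).trans_lt hn2
  intro s hs X
  rw [not_not] at hs
  -- A receiver that almost surely receives nothing has an empty message to decode.
  rcases (ch.pUnion_nonneg {k}).eq_or_lt with hk | hk
  · funext j
    exact absurd j.2 (by simp [hR0 k hk.symm])
  refine σ.plan.decoded_code grp hdr hFK hdr.injective (fun j => ?_)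
    (hs.exists_header hσtotal hn0 ((hδμ.trans_le hle₄).trans_le (by simpa using hhead k hk)) hk) X
  by_contra hkS
  set S := (σ.plan.evolve F grp (extendPattern s) σ.total).heard k j with hSdef
  set g := grp k j with hg
  have hS : S ⊆ {k}ᶜ := fun a ha => by
    rw [Finset.mem_compl, Finset.mem_singleton]
    rintro rfl
    exact hkS ha
  have hpos : 0 < packetCount grp (σ.plan.evolve F grp (extendPattern s) σ.total) k g S :=
    packetCount_pos.2 ⟨j, rfl, rfl⟩
  refine hpos.ne' (packetCount_eq_zero (hcard g) hS ?_ ?_ (σ.blockEnd_le_total le_rfl hS))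
  -- All packets start with overhearing set `∅`. There the rate inequality plays the role of
  -- clean-up, with the packets of the group as the only arrivals.
  · by_cases hS0 : S = ∅
    · have ha : (packetCount grp (PacketState.init _ F) k g S : ℝ) ≤ n * R g k + 1 := by
        have h1 : packetCount grp (PacketState.init _ F) k g S ≤ ⌈(n : ℝ) * R g k⌉₊ :=
          (packetCount_le grp _ k g S).trans (hgrp k g)
        have h2 := (Nat.ceil_lt_add_one (mul_nonneg hn0'.le (hR g k))).le
        exact le_trans (by exact_mod_cast h1) h2
      refine hs.hits_balance hσn hS (w := w g k) ((h g).w_nonneg k) (fun _ _ => rfl) hδ hn1 ha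
        subset_rfl (fun T hT => by simpa using hT) ?_
      have hent : entering k S = ∅ := by simp [entering, hS0]
      have hsub : (Finset.univ.filter fun T : Finset (Fin K) => T ⊆ S) = {∅} := by
        ext; simp [hS0, Finset.subset_empty]
      rw [hent, hsub, hS0]
      have := hrate (g, k) hk
      simp only [Finset.sum_empty, Finset.sum_singleton, Finset.compl_empty]
      linarith
    · refine hs.hits_balance hσn hS (w := w g k) (c := 0) ((h g).w_nonneg k) (fun _ _ => rfl) hδ hn1
        ?_ subset_rfl (fun T hT => by simpa using hT) ?_
      · have : packetCount grp (PacketState.init _ F) k g S = 0 := by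
          simp [packetCount, PacketState.init, Ne.symm hS0]
        rw [this]
        simp
      · have := hclean (g, k, S) ⟨hk, hS, hS0⟩
        simp only at this
        linarith
  · intro T hT hne
    have := hs.hits_balance (a := 0) hσn hS (w := w g k) (c := 0) ((h g).w_nonneg k)
      (fun _ _ => rfl) hδ hn1 (by simp)
      (Q := (entering k S).filter fun q => σ.Before k g T S q.2 q.1) (Finset.filter_subset _ _)
      (𝒯 := Finset.univ.filter fun T₁ => T₁ ⊆ S ∧ σ.order g (T ∪ {k}) (T₁ ∪ {k}))
      (fun T₁ hT₁ => (Finset.mem_filter.1 hT₁).2.1) (by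
        have := hlate (g, k, S, T) ⟨hk, hT, hS, hne⟩
        simp only at this
        have h' : ∑ q ∈ (entering k S).filter (fun q => σ.Before k g T S q.2 q.1),
            w g k q.1 q.2 * ch.fp (S \ q.2) Sᶜ + μ₃ ≤
          (∑ T₁ with T₁ ⊆ S ∧ σ.order g (T ∪ {k}) (T₁ ∪ {k}), w g k S T₁) * ch.pUnion Sᶜ := by
          convert this <;> rfl
        linarith)
    rwa [zero_add] at this

end

/-! ### Time sharing between points of the regions -/

theorem mainTheorem8 (K : ℕ) (ch : BroadcastPEC K) :
    ∀ R ∈ convexHull ℝ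
      (⋃ r ∈ {r : Finset (Fin K) → Finset (Fin K) → Prop |
        IsStrictTotalOrder (Finset (Fin K)) r ∧ CardCompatible r}, innerRegion ch r),
      ch.Achievable R := by
  intro R hR
  obtain ⟨ι, _, c, z, hc0, hc1, hz, rfl⟩ := mem_convexHull_iff_exists_fintype.1 hR
  -- The points of the convex combination index the groups; any order of service will do.
  let _ : LinearOrder ι := LinearOrder.lift' (Fintype.equivFin ι) (Fintype.equivFin ι).injective
  simp only [Set.mem_iUnion, Set.mem_ofPred_eq, exists_prop] at hz
  choose r hr hz using hz
  have hz0 : ∀ i k, 0 ≤ z i k := fun i => (hz i).1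
  choose x w hf using fun i => (hz i).2
  have hle1 : ∀ i, c i ≤ 1 := fun i =>
    hc1 ▸ Finset.single_le_sum (fun j _ => hc0 j) (Finset.mem_univ i)
  have hlt : ∑ i, c i * ∑ S, x i S < 1 := by
    rw [← hc1]
    obtain ⟨i, hi⟩ : ∃ i, 0 < c i := by
      by_contra! hneg
      have := Finset.sum_nonpos fun i (_ : i ∈ Finset.univ) => hneg i
      linarith
    exact Finset.sum_lt_sum (fun j _ => mul_le_of_le_one_right (hc0 j) (hf j).total.le)
      ⟨i, Finset.mem_univ i, mul_lt_of_lt_one_right hi (hf i).total⟩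
  -- With `card + 1` in the denominator, the `card ι` increments of `η` keep the total length below
  -- 1.
  set η : ℝ := (1 - ∑ i, c i * ∑ S, x i S) / (Fintype.card ι + 1) with hη
  have hη0 : 0 < η := div_pos (by linarith) (by positivity)
  have hex : ∀ i, ∃ x' w', StrictlyFeasible ch (r i) (fun k => c i * z i k) x' w' ∧
      ∑ S, x' S ≤ ∑ S, c i * x i S + η := fun i =>
    have := (hr i).1
    ((hf i).smul (hc0 i) (hle1 i)).exists_strictlyFeasible (hr i).2 hη0
  choose x' w' hx' hsum using hex
  have hR : (∑ i, c i • z i) = fun k => ∑ i, c i * z i k := by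
    funext k
    simp
  rw [hR]
  refine achievable_of_strictlyFeasible (fun i => (hr i).1) (fun i => (hr i).2) hx'
    (fun i k => mul_nonneg (hc0 i) (hz0 i k)) (fun k hk => ?_) ?_
  · refine Finset.sum_eq_zero fun i _ => ?_
    rw [le_antisymm ((hf i).rate_nonpos hk) (hz0 i k), mul_zero]
  · calc ∑ i, ∑ S, x' i S ≤ ∑ i, (c i * ∑ S, x i S + η) := by
          refine Finset.sum_le_sum fun i _ => ?_
          rw [Finset.mul_sum]
          exact hsum i
      _ = ∑ i, c i * ∑ S, x i S + Fintype.card ι * η := by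
          rw [Finset.sum_add_distrib, Finset.sum_const, Finset.card_univ, nsmul_eq_mul]
      _ < ∑ i, c i * ∑ S, x i S + (Fintype.card ι + 1) * η := by linarith
      _ = 1 := by
          rw [hη]
          field_simp
          ring
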